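/- A digraph here is a finite oriented graph, i.e. it is obtained from a finite simple graph by giving an orientation to each edge; its chromatic number is the chromatic number of the underlying graph. Let $C(1,1,1,1,1,1)$ denote the oriented cycle formed of six blocks (maximal directed subpaths) of length $1$ each, i.e. the antidirected cycle on six vertices. A subdivision of a digraph $H$ is obtained from $H$ by replacing each arc $(x,y)$ of $H$ by a directed path from $x$ to $y$ of length at least $1$, where all the new paths are internally disjoint. Let $D$ be a strongly connected digraph (for any two vertices $x,y$ there is a directed path from $x$ to $y$) that contains no subdivision of $C(1,1,1,1,1,1)$ as a subdigraph. Then $$\chi(D)\le 7\cdot 16^2.$$ -/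

import Mathlib

namespace Digraph

variable {V W : Type*}

/-- `D` is an orientation of a simple graph: it has no loop, and at most one of `(x, y)`, `(y, x)`
is an arc. -/
def IsOriented (D : Digraph V) : Prop :=
  ∀ x y, D.Adj x y → ¬ D.Adj y x

/-- `p` is the list of vertices of a directed path of `D` from `x` to `y`; vertices do not repeat,
and the length of the path is its number of arcs, `p.length - 1`. -/
structure IsDirectedPath (D : Digraph V) (x y : V) (p : List V) : Prop where
  isChain : p.IsChain D.Adj
  nodup : p.Nodup
  head : p.head? = some x
  last : p.getLast? = some y

/-- Any two vertices are joined by a directed path. -/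
def IsStronglyConnected (D : Digraph V) : Prop :=
  ∀ x y, ∃ p, D.IsDirectedPath x y p

/-- The digraph `D` contains a subdivision of the loopless digraph `H` as a subdigraph: distinct
vertices `f a` of `D` stand for the vertices `a` of `H`, each arc `(a, b)` of `H` is replaced by a
directed path `P a b` of `D` of length at least `1` from `f a` to `f b`, no vertex `f c` is an
internal vertex of any of these paths, and two paths replacing distinct arcs of `H` meet only in
vertices of the form `f c`. -/
def ContainsSubdivision (D : Digraph V) (H : Digraph W) : Prop :=
  ∃ (f : W → V) (P : W → W → List V),
    Function.Injective f ∧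
    (∀ a b, H.Adj a b → D.IsDirectedPath (f a) (f b) (P a b) ∧ 1 ≤ (P a b).length - 1) ∧
    (∀ a b, H.Adj a b → ∀ c, f c ∈ P a b → c = a ∨ c = b) ∧
    (∀ a b c d, H.Adj a b → H.Adj c d → (a, b) ≠ (c, d) →
      ∀ v, v ∈ P a b → v ∈ P c d → ∃ e, v = f e)

/-- The directions of the successive edges along a cycle with blocks of lengths `k₁, …, kₙ`:
`k₁` times `b`, then `k₂` times the opposite of `b`, and so on. -/
def blockDirections : Bool → List ℕ → List Bool
  | _, [] => []
  | b, k :: ks => List.replicate k b ++ blockDirections (!b) ks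

/-- The oriented cycle `C(k₁, …, kₙ)` formed of `n` blocks of lengths `k₁, …, kₙ` (for an even
number `n` of positive lengths with sum at least `3`). The vertices are arranged cyclically, and
the edge between the `i`-th vertex and its successor `finRotate _ i` is directed forwards or
backwards according to the `i`-th direction. -/
def blockCycle (ks : List ℕ) : Digraph (Fin (blockDirections true ks).length) where
  Adj x y := ∃ i, ((blockDirections true ks).get i = true ∧ x = i ∧ y = finRotate _ i) ∨
    ((blockDirections true ks).get i = false ∧ x = finRotate _ i ∧ y = i)

/-- `C(1,1,1,1,1,1)` is the cycle on `0, …, 5` in which the even vertices are sources and the odd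
vertices are sinks. -/
theorem blockCycle_ones_adj (x y : Fin 6) :
    (blockCycle [1, 1, 1, 1, 1, 1]).Adj x y ↔
      x.val % 2 = 0 ∧ (y = x + 1 ∨ x = y + 1) := by
  change (∃ i : Fin 6, (([true, false, true, false, true, false] : List Bool).get i = true ∧
      x = i ∧ y = finRotate 6 i) ∨
    (([true, false, true, false, true, false] : List Bool).get i = false ∧
      x = finRotate 6 i ∧ y = i)) ↔ _
  revert x y
  decide

/-- The chromatic number of a digraph is that of its underlying graph. -/
noncomputable def chromaticNumber (D : Digraph V) : ℕ∞ :=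
  D.toSimpleGraphInclusive.chromaticNumber

end Digraph

/-! Call a relation k-sparse if every finite set S of vertices spans at most k|S| of its pairs. If
the arcs of a digraph are k-sparse, each of its induced subdigraphs has a vertex of total degree at
most 2k, so greedy colouring needs at most 2k + 1 colours. Sparsity constants add over unions, so
the arcs may be split along a breadth-first tree: arcs to descendants are tree arcs (constant 1),
arcs to ancestors have constant 58, and arcs between incomparable vertices have constant 28 in each
of the directions left and right of a plane drawing. The total 115 gives 231 colours, well below 7 ·
16².

Each constant comes from peeling. Removing at every vertex the arc to its extremal out-neighbour (or
from its extremal in-neighbour) costs 1, and every surviving arc gains a witness further along the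
order. After boundedly many rounds a surviving arc would carry enough witnesses to close an
antidirected hexagon with the help of tree paths, so nothing survives.

For cross arcs the hexagon is a fork: two tree paths leave the meet of two incomparable vertices and
a zigzag of arcs joins their ends (`IsTreeOrder.hasHexagon_cross`). For back arcs, forks settle the
case where tails of a common head are incomparable (`IsBack.sparse_of_in_antichain`). This case then
serves as a stronger peeling step, of cost 6, producing comparable tails; the remaining
configurations lie along chains (`IsTreeOrder.hasHexagon_of_nested`, `IsBack.hasHexagon_of_strict`).
-/

namespace Digraph

/-! ### Sparse relations and colouring -/

variable {V : Type*}

open scoped Classical in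
/-- Every finite set `S` of vertices spans at most `k * #S` pairs of the relation `E`. -/
def Sparse (k : ℕ) (E : V → V → Prop) : Prop :=
  ∀ S : Finset V, ((S ×ˢ S).filter fun e => E e.1 e.2).card ≤ k * S.card

theorem Sparse.union {k l : ℕ} {E F G : V → V → Prop} (hE : Sparse k E) (hF : Sparse l F)
    (h : ∀ x y, G x y → E x y ∨ F x y) : Sparse (k + l) G := by
  classical
  intro S
  have h1 := hE S
  have h2 := hF S
  have h3 : ((S ×ˢ S).filter fun e => G e.1 e.2) ⊆
      ((S ×ˢ S).filter fun e => E e.1 e.2) ∪ ((S ×ˢ S).filter fun e => F e.1 e.2) := by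
    intro e he
    simp only [Finset.mem_filter, Finset.mem_union] at he ⊢
    rcases h _ _ he.2 with h' | h'
    · exact Or.inl ⟨he.1, h'⟩
    · exact Or.inr ⟨he.1, h'⟩
  have h4 := (Finset.card_le_card h3).trans (Finset.card_union_le _ _)
  have h5 : (k + l) * S.card = k * S.card + l * S.card := by ring
  have h6 : ((S ×ˢ S).filter fun e => G e.1 e.2).card ≤
    ((S ×ˢ S).filter fun e => E e.1 e.2).card + ((S ×ˢ S).filter fun e => F e.1 e.2).card := by
    convert h4
  rw [h5]
  refine le_trans ?_ (Nat.add_le_add h1 h2)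
  convert h6

theorem sparse_zero {E : V → V → Prop} (h : ∀ x y, ¬ E x y) : Sparse 0 E := by
  classical
  intro S
  rw [Finset.filter_false_of_mem fun e _ => h _ _]
  simp

/-- The injection may depend on `S`; `IsBack.sparse_one_of_branch` needs this freedom. -/
theorem sparse_one_of_injOn {E : V → V → Prop}
    (h : ∀ S : Finset V, ∃ g : V × V → V, (∀ x ∈ S, ∀ y ∈ S, E x y → g (x, y) ∈ S) ∧
      ∀ x ∈ S, ∀ y ∈ S, ∀ x' ∈ S, ∀ y' ∈ S, E x y → E x' y' → g (x, y) = g (x', y') →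
        x = x' ∧ y = y') : Sparse 1 E := by
  classical
  intro S
  obtain ⟨g, h1, h2⟩ := h S
  rw [one_mul]
  refine Finset.card_le_card_of_injOn g ?_ ?_
  · rintro ⟨x, y⟩ he
    simp only [Finset.coe_filter, Finset.mem_product, Set.mem_ofPred_eq] at he
    exact h1 x he.1.1 y he.1.2 he.2
  · rintro ⟨x, y⟩ he ⟨x', y'⟩ he' hg
    simp only [Finset.coe_filter, Finset.mem_product, Set.mem_ofPred_eq] at he he'
    exact Prod.ext_iff.2 (h2 x he.1.1 y he.1.2 x' he'.1.1 y' he'.1.2 he.2 he'.2 hg)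

theorem sparse_one_of_out {E : V → V → Prop} (h : ∀ x y y', E x y → E x y' → y = y') :
    Sparse 1 E := by
  refine sparse_one_of_injOn fun S => ⟨Prod.fst, fun x hx _ _ _ => hx, ?_⟩
  rintro x - y - x' - y' - h1 h2 (rfl : x = x')
  exact ⟨rfl, h _ _ _ h1 h2⟩

theorem sparse_one_of_in {E : V → V → Prop} (h : ∀ x x' y, E x y → E x' y → x = x') :
    Sparse 1 E := by
  refine sparse_one_of_injOn fun S => ⟨Prod.snd, fun _ _ y hy _ => hy, ?_⟩
  rintro x - y - x' - y' - h1 h2 (rfl : y = y')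
  exact ⟨h _ _ _ h1 h2, rfl⟩

/-- Degeneracy: colour all but a vertex of small degree, then give that vertex a colour absent from
its neighbours. -/
theorem Sparse.exists_coloring {k : ℕ} {D : Digraph V} (h : Sparse k D.Adj) (S : Finset V) :
    ∃ c : V → Fin (2 * k + 1), ∀ x ∈ S, ∀ y ∈ S, x ≠ y → D.Adj x y → c x ≠ c y := by
  classical
  induction hn : S.card generalizing S with
  | zero =>
    rw [Finset.card_eq_zero] at hn
    subst hn
    exact ⟨fun _ => 0, by simp⟩
  | succ n ih =>
    have hS := h S
    have e1 : ((S ×ˢ S).filter fun e => D.Adj e.1 e.2).card =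
        ∑ x ∈ S, (S.filter fun y => D.Adj x y).card := by
      rw [Finset.card_filter, Finset.sum_product]
      simp_rw [Finset.card_filter]
    have e2 : ((S ×ˢ S).filter fun e => D.Adj e.1 e.2).card =
        ∑ x ∈ S, (S.filter fun y => D.Adj y x).card := by
      rw [Finset.card_filter, Finset.sum_product_right]
      simp_rw [Finset.card_filter]
    -- Out-degrees and in-degrees each sum to the number of arcs in `S`, so the average total degree
    -- is at most `2 * k`.
    obtain ⟨x, hx, hdeg⟩ : ∃ x ∈ S, (S.filter fun y => D.Adj x y).card +
        (S.filter fun y => D.Adj y x).card ≤ 2 * k := by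
      refine Finset.exists_le_of_sum_le (Finset.card_pos.1 (by omega)) ?_
      rw [Finset.sum_add_distrib, ← e1, ← e2, Finset.sum_const, smul_eq_mul]
      have : S.card * (2 * k) = k * S.card + k * S.card := by ring
      rw [this]
      refine Nat.add_le_add ?_ ?_ <;> convert hS
    obtain ⟨c, hc⟩ := ih (S.erase x) (by rw [Finset.card_erase_of_mem hx]; omega)
    obtain ⟨i, hi⟩ : ∃ i, i ∉ ((S.filter fun y => D.Adj x y) ∪
        (S.filter fun y => D.Adj y x)).image c := by
      by_contra! hcon
      have h1 : (Finset.univ : Finset (Fin (2 * k + 1))) ⊆ _ := fun i _ => hcon i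
      have h2 := Finset.card_le_card h1
      have h3 := h2.trans (Finset.card_image_le.trans (Finset.card_union_le _ _))
      rw [Finset.card_univ, Fintype.card_fin] at h3
      omega
    simp only [Finset.mem_image, Finset.mem_union, Finset.mem_filter, not_exists, not_and] at hi
    refine ⟨Function.update c x i, fun y hy z hz hyz hadj => ?_⟩
    by_cases h1 : y = x
    · subst h1
      rw [Function.update_self, Function.update_of_ne (Ne.symm hyz)]
      exact Ne.symm (hi z (Or.inl ⟨hz, hadj⟩))
    · by_cases h2 : z = x
      · subst h2
        rw [Function.update_self, Function.update_of_ne h1]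
        exact hi y (Or.inr ⟨hy, hadj⟩)
      · rw [Function.update_of_ne h1, Function.update_of_ne h2]
        exact hc y (Finset.mem_erase.2 ⟨h1, hy⟩) z (Finset.mem_erase.2 ⟨h2, hz⟩) hyz hadj

theorem Sparse.chromaticNumber_le [Finite V] {k : ℕ} {D : Digraph V} (h : Sparse k D.Adj) :
    D.chromaticNumber ≤ (2 * k + 1 : ℕ) := by
  have := Fintype.ofFinite V
  obtain ⟨c, hc⟩ := h.exists_coloring Finset.univ
  refine SimpleGraph.Colorable.chromaticNumber_le ⟨SimpleGraph.Coloring.mk c ?_⟩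
  intro x y hxy
  rw [Digraph.toSimpleGraphInclusive, SimpleGraph.fromRel_adj] at hxy
  rcases hxy.2 with h' | h'
  · exact hc x (Finset.mem_univ _) y (Finset.mem_univ _) hxy.1 h'
  · exact (hc y (Finset.mem_univ _) x (Finset.mem_univ _) (Ne.symm hxy.1) h').symm

/-! ### Peeling extremal arcs -/

section Layers

variable {E : V → V → Prop} {k : ℕ}

theorem Sparse.split (P : V → V → Prop) {l : ℕ} (h1 : Sparse k fun y b => E y b ∧ ¬ P y b)
    (h2 : Sparse l fun y b => E y b ∧ P y b) : Sparse (k + l) E :=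
  h1.union h2 fun x y h => by by_cases hp : P x y <;> simp [h, hp]

/-- Peeling off, at every vertex, the extremal out-neighbour for `r`. -/
theorem Sparse.peel_out (r : V → V → Prop)
    (hr : ∀ y b b', E y b → E y b' → b ≠ b' → r b b' ∨ r b' b)
    (h : Sparse k fun y b => E y b ∧ ∃ a, E y a ∧ r b a) : Sparse (1 + k) E := by
  refine Sparse.split _ (sparse_one_of_out ?_) h
  rintro y b b' ⟨h1, h2⟩ ⟨h3, h4⟩
  by_contra hne
  push Not at h2 h4
  rcases hr y b b' h1 h3 hne with h5 | h5
  · exact h2 _ h3 h5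
  · exact h4 _ h1 h5

/-- Peeling off, at every vertex, the extremal in-neighbour for `r`. -/
theorem Sparse.peel_in (r : V → V → Prop)
    (hr : ∀ y y' b, E y b → E y' b → y ≠ y' → r y y' ∨ r y' y)
    (h : Sparse k fun y b => E y b ∧ ∃ x, E x b ∧ r y x) : Sparse (1 + k) E := by
  refine Sparse.split _ (sparse_one_of_in ?_) h
  rintro y y' b ⟨h1, h2⟩ ⟨h3, h4⟩
  by_contra hne
  push Not at h2 h4
  rcases hr y y' b h1 h3 hne with h5 | h5
  · exact h2 _ h3 h5
  · exact h4 _ h1 h5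

end Layers


/-! ### Hexagons assembled from directed paths -/

/-- `D` has a directed path from `x` to `y` all of whose internal vertices lie in `S`. -/
def ReachVia (D : Digraph V) (S : Set V) (x y : V) : Prop :=
  ∃ p, D.IsDirectedPath x y p ∧ ∀ v ∈ p, v = x ∨ v = y ∨ v ∈ S

/-- `D` contains a subdivision of `C(1,1,1,1,1,1)`. -/
def HasHexagon (D : Digraph V) : Prop :=
  D.ContainsSubdivision (blockCycle [1, 1, 1, 1, 1, 1])

theorem IsDirectedPath.cons {D : Digraph V} {s x y : V} {p : List V} (hp : D.IsDirectedPath x y p)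
    (h : D.Adj s x) (hs : s ∉ p) : D.IsDirectedPath s y (s :: p) where
  isChain := by
    refine hp.isChain.cons fun z hz => ?_
    rw [hp.head, Option.mem_some_iff] at hz
    exact hz ▸ h
  nodup := List.nodup_cons.2 ⟨hs, hp.nodup⟩
  head := rfl
  last := by rw [List.getLast?_cons, hp.last]; rfl

theorem IsDirectedPath.snoc {D : Digraph V} {x y t : V} {p : List V} (hp : D.IsDirectedPath x y p)
    (h : D.Adj y t) (ht : t ∉ p) : D.IsDirectedPath x t (p ++ [t]) where
  isChain := by
    refine List.IsChain.append hp.isChain (List.isChain_singleton _) fun z hz w hw => ?_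
    rw [hp.last, Option.mem_some_iff] at hz
    simp only [List.head?_cons, Option.mem_some_iff] at hw
    exact hz ▸ hw ▸ h
  nodup := by
    rw [List.nodup_append]
    exact ⟨hp.nodup, List.nodup_singleton _, fun a ha b hb => by
      rw [List.mem_singleton] at hb; rintro rfl; exact ht (hb ▸ ha)⟩
  head := by rw [List.head?_append, hp.head]; rfl
  last := by simp

theorem IsDirectedPath.single (D : Digraph V) (x : V) : D.IsDirectedPath x x [x] where
  isChain := List.isChain_singleton _
  nodup := List.nodup_singleton _
  head := rfl
  last := rfl

theorem IsDirectedPath.two_le_length {D : Digraph V} {x y : V} {p : List V}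
    (hp : D.IsDirectedPath x y p) (h : x ≠ y) : 1 ≤ p.length - 1 := by
  have h1 := hp.head
  have h2 := hp.last
  match p, h1, h2 with
  | [a], h1, h2 => simp_all
  | a :: b :: l, h1, h2 => simp

theorem ReachVia.of_adj {D : Digraph V} {x y : V} (h : D.Adj x y) (hne : x ≠ y) :
    D.ReachVia ∅ x y :=
  ⟨[x, y], (IsDirectedPath.single D y).cons h (by simpa using hne), by simp⟩

theorem hasHexagon_of_reachVia {D : Digraph V} (f : Fin 6 → V) (S : Fin 6 → Fin 6 → Set V)
    (hf : Function.Injective f)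
    (h : ∀ i j : Fin 6, i.val % 2 = 0 ∧ (j = i + 1 ∨ i = j + 1) → D.ReachVia (S i j) (f i) (f j))
    (hS : ∀ i j c : Fin 6, i.val % 2 = 0 ∧ (j = i + 1 ∨ i = j + 1) → f c ∉ S i j)
    (hd : ∀ i j k l : Fin 6, i.val % 2 = 0 ∧ (j = i + 1 ∨ i = j + 1) →
      k.val % 2 = 0 ∧ (l = k + 1 ∨ k = l + 1) → (i, j) ≠ (k, l) → ∀ v ∈ S i j, v ∉ S k l) :
    D.HasHexagon := by
  choose! P hP1 hP2 using h
  refine ⟨f, P, hf, fun a b hab => ?_, fun a b hab c hc => ?_,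
    fun a b c d hab hcd hne v h1 h2 => ?_⟩
  · have hab' := (blockCycle_ones_adj a b).1 hab
    refine ⟨hP1 a b hab', (hP1 a b hab').two_le_length fun hh => ?_⟩
    have := hf hh
    subst this
    revert hab'
    generalize (show Fin 6 from a) = i
    revert i
    decide
  · have hab' := (blockCycle_ones_adj a b).1 hab
    rcases hP2 a b hab' _ hc with h1 | h1 | h1
    · exact Or.inl (hf h1)
    · exact Or.inr (hf h1)
    · exact absurd h1 (hS a b c hab')
  · have hab' := (blockCycle_ones_adj a b).1 hab
    have hcd' := (blockCycle_ones_adj c d).1 hcd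
    rcases hP2 a b hab' _ h1 with h3 | h3 | h3
    · exact ⟨_, h3⟩
    · exact ⟨_, h3⟩
    rcases hP2 c d hcd' _ h2 with h4 | h4 | h4
    · exact ⟨_, h4⟩
    · exact ⟨_, h4⟩
    exact absurd h4 (hd a b c d hab' hcd' hne v h3)

/-- Three sources `a, b, c` and three sinks `x, y, z` joined cyclically by six directed paths. -/
theorem hasHexagon_of_six {D : Digraph V} {a x b y c z : V} {S : Fin 6 → Set V}
    (hnd : [a, x, b, y, c, z].Nodup)
    (h0 : D.ReachVia (S 0) a x) (h1 : D.ReachVia (S 1) b x) (h2 : D.ReachVia (S 2) b y)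
    (h3 : D.ReachVia (S 3) c y) (h4 : D.ReachVia (S 4) c z) (h5 : D.ReachVia (S 5) a z)
    (hS : ∀ i, ∀ v ∈ [a, x, b, y, c, z], v ∉ S i)
    (hd : ∀ i j, i ≠ j → ∀ v ∈ S i, v ∉ S j) : D.HasHexagon := by
  have key : ∀ i j : Fin 6, i.val % 2 = 0 ∧ (j = i + 1 ∨ i = j + 1) →
      (i = 0 ∧ j = 1) ∨ (i = 2 ∧ j = 1) ∨ (i = 2 ∧ j = 3) ∨ (i = 4 ∧ j = 3) ∨ (i = 4 ∧ j = 5) ∨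
      (i = 0 ∧ j = 5) := by decide
  let g : Fin 6 → Fin 6 → Fin 6 := fun i j =>
    if i = 0 then (if j = 1 then 0 else 5) else if i = 2 then (if j = 1 then 1 else 2)
    else (if j = 3 then 3 else 4)
  refine hasHexagon_of_reachVia ![a, x, b, y, c, z] (fun i j => S (g i j)) ?_ ?_ ?_ ?_
  · simp only [List.nodup_cons, List.mem_cons, List.not_mem_nil, or_false, not_or] at hnd
    intro i j hij
    fin_cases i <;> fin_cases j <;> simp at hij ⊢ <;> grind
  · intro i j hij
    rcases key i j hij with h | h | h | h | h | h <;> obtain ⟨rfl, rfl⟩ := h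
    exacts [h0, h1, h2, h3, h4, h5]
  · intro i j k _
    refine hS _ _ ?_
    fin_cases k <;> simp
  · intro i j k l hij hkl hne
    refine hd _ _ ?_
    rcases key i j hij with h | h | h | h | h | h <;> obtain ⟨rfl, rfl⟩ := h <;>
    rcases key k l hkl with h | h | h | h | h | h <;> obtain ⟨rfl, rfl⟩ := h <;>
      first
      | exact absurd rfl hne
      | decide

section TwoPaths

variable {D : Digraph V} {a x b y c z : V} {S T : Set V}

theorem hasHexagon_of_fork (hnd : [a, x, b, y, c, z].Nodup)
    (hx : D.ReachVia S a x) (hz : D.ReachVia T a z)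
    (hbx : D.Adj b x) (hby : D.Adj b y) (hcy : D.Adj c y) (hcz : D.Adj c z)
    (hS : ∀ v ∈ [a, x, b, y, c, z], v ∉ S) (hT : ∀ v ∈ [a, x, b, y, c, z], v ∉ T)
    (hd : ∀ v ∈ S, v ∉ T) : D.HasHexagon := by
  have hnd' := hnd
  simp only [List.nodup_cons, List.mem_cons, List.not_mem_nil, or_false, not_or] at hnd'
  refine hasHexagon_of_six (S := ![S, ∅, ∅, ∅, ∅, T]) hnd hx (.of_adj hbx ?_) (.of_adj hby ?_)
    (.of_adj hcy ?_) (.of_adj hcz ?_) hz ?_ ?_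
  any_goals grind
  · intro i v hv
    fin_cases i
    exacts [hS v hv, id, id, id, id, hT v hv]
  · intro i j hij v hi hj
    fin_cases i <;> fin_cases j <;>
      first | exact hij rfl | exact hi | exact hj | exact hd v hi hj | exact hd v hj hi

theorem hasHexagon_of_skip (hnd : [a, x, b, y, c, z].Nodup)
    (hx : D.ReachVia S a x) (hy : D.ReachVia T b y)
    (hbx : D.Adj b x) (hcy : D.Adj c y) (hcz : D.Adj c z) (haz : D.Adj a z)
    (hS : ∀ v ∈ [a, x, b, y, c, z], v ∉ S) (hT : ∀ v ∈ [a, x, b, y, c, z], v ∉ T)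
    (hd : ∀ v ∈ S, v ∉ T) : D.HasHexagon := by
  have hnd' := hnd
  simp only [List.nodup_cons, List.mem_cons, List.not_mem_nil, or_false, not_or] at hnd'
  refine hasHexagon_of_six (S := ![S, ∅, T, ∅, ∅, ∅]) hnd hx (.of_adj hbx ?_) hy
    (.of_adj hcy ?_) (.of_adj hcz ?_) (.of_adj haz ?_) ?_ ?_
  any_goals grind
  · intro i v hv
    fin_cases i
    exacts [hS v hv, id, hT v hv, id, id, id]
  · intro i j hij v hi hj
    fin_cases i <;> fin_cases j <;>
      first | exact hij rfl | exact hi | exact hj | exact hd v hi hj | exact hd v hj hi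

theorem hasHexagon_of_opposite (hnd : [a, x, b, y, c, z].Nodup)
    (hx : D.ReachVia S a x) (hy : D.ReachVia T c y)
    (hbx : D.Adj b x) (hby : D.Adj b y) (hcz : D.Adj c z) (haz : D.Adj a z)
    (hS : ∀ v ∈ [a, x, b, y, c, z], v ∉ S) (hT : ∀ v ∈ [a, x, b, y, c, z], v ∉ T)
    (hd : ∀ v ∈ S, v ∉ T) : D.HasHexagon := by
  have hnd' := hnd
  simp only [List.nodup_cons, List.mem_cons, List.not_mem_nil, or_false, not_or] at hnd'
  refine hasHexagon_of_six (S := ![S, ∅, ∅, T, ∅, ∅]) hnd hx (.of_adj hbx ?_) (.of_adj hby ?_)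
    hy (.of_adj hcz ?_) (.of_adj haz ?_) ?_ ?_
  any_goals grind
  · intro i v hv
    fin_cases i
    exacts [hS v hv, id, id, hT v hv, id, id]
  · intro i j hij v hi hj
    fin_cases i <;> fin_cases j <;>
      first | exact hij rfl | exact hi | exact hj | exact hd v hi hj | exact hd v hj hi

end TwoPaths

/-! ### Tree orders, plane orders and forks -/

/-- The ancestor order of a spanning out-tree of a loopless digraph. -/
structure IsTreeOrder [PartialOrder V] (D : Digraph V) : Prop where
  loopless : ∀ x, ¬ D.Adj x x
  chain : ∀ {x y z : V}, x ≤ z → y ≤ z → x ≤ y ∨ y ≤ x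
  inf : ∀ x y : V, ∃ z, z ≤ x ∧ z ≤ y ∧ ∀ w, w ≤ x → w ≤ y → w ≤ z
  path : ∀ {x y : V}, x ≤ y → ∃ p, D.IsDirectedPath x y p ∧ ∀ v ∈ p, x ≤ v ∧ v ≤ y

namespace IsTreeOrder

variable [PartialOrder V] {D : Digraph V} (hT : D.IsTreeOrder)

include hT

theorem ne {x y : V} (h : D.Adj x y) : x ≠ y := by
  rintro rfl
  exact hT.loopless _ h

theorem reach {x y : V} (h : x ≤ y) : D.ReachVia {v | x < v ∧ v < y} x y := by
  obtain ⟨p, hp, hv⟩ := hT.path h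
  refine ⟨p, hp, fun v hvp => ?_⟩
  have := hv v hvp
  by_cases h1 : v = x
  · exact Or.inl h1
  by_cases h2 : v = y
  · exact Or.inr (Or.inl h2)
  exact Or.inr (Or.inr ⟨lt_of_le_of_ne this.1 (Ne.symm h1), lt_of_le_of_ne this.2 h2⟩)

theorem reach_snoc {x y t : V} (h : x ≤ y) (hyt : D.Adj y t) (ht : x ≤ t → ¬ t ≤ y) :
    D.ReachVia {v | x < v ∧ v ≤ y} x t := by
  obtain ⟨p, hp, hv⟩ := hT.path h
  refine ⟨p ++ [t], hp.snoc hyt fun h' => ht (hv _ h').1 (hv _ h').2, fun v hvp => ?_⟩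
  rw [List.mem_append, List.mem_singleton] at hvp
  rcases hvp with hvp | hvp
  · have := hv v hvp
    by_cases h1 : v = x
    · exact Or.inl h1
    exact Or.inr (Or.inr ⟨lt_of_le_of_ne this.1 (Ne.symm h1), this.2⟩)
  · exact Or.inr (Or.inl hvp)

theorem reach_cons {s x y : V} (hsx : D.Adj s x) (h : x ≤ y) (hs : x ≤ s → ¬ s ≤ y) :
    D.ReachVia {v | x ≤ v ∧ v < y} s y := by
  obtain ⟨p, hp, hv⟩ := hT.path h
  refine ⟨s :: p, hp.cons hsx fun h' => hs (hv _ h').1 (hv _ h').2, fun v hvp => ?_⟩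
  rw [List.mem_cons] at hvp
  rcases hvp with hvp | hvp
  · exact Or.inl hvp
  · have := hv v hvp
    by_cases h1 : v = y
    · exact Or.inr (Or.inl h1)
    exact Or.inr (Or.inr ⟨this.1, lt_of_le_of_ne this.2 h1⟩)

theorem reach_cons_snoc {s x y t : V} (hsx : D.Adj s x) (h : x ≤ y) (hyt : D.Adj y t)
    (hs : x ≤ s → ¬ s ≤ y) (ht : x ≤ t → ¬ t ≤ y) (hst : s ≠ t) :
    D.ReachVia {v | x ≤ v ∧ v ≤ y} s t := by
  obtain ⟨p, hp, hv⟩ := hT.path h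
  refine ⟨s :: (p ++ [t]), (hp.snoc hyt fun h' => ht (hv _ h').1 (hv _ h').2).cons hsx ?_,
    fun v hvp => ?_⟩
  · rw [List.mem_append, List.mem_singleton]
    rintro (h' | h')
    · exact hs (hv _ h').1 (hv _ h').2
    · exact hst h'
  rw [List.mem_cons, List.mem_append, List.mem_singleton] at hvp
  rcases hvp with hvp | hvp | hvp
  · exact Or.inl hvp
  · exact Or.inr (Or.inr (hv v hvp))
  · exact Or.inr (Or.inl hvp)

end IsTreeOrder


/-- A linear preorder traversal of a tree order: ancestors come first, and the descendants of a
vertex form an interval. -/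
structure IsPlaneOrder [PartialOrder V] (r : V → V → Prop) : Prop where
  asymm : ∀ {x y}, r x y → ¬ r y x
  trans : ∀ {x y z}, r x y → r y z → r x z
  total : ∀ {x y}, x ≠ y → r x y ∨ r y x
  of_lt : ∀ {x y : V}, x < y → r x y
  interval : ∀ {x y z : V}, x ≤ z → r x y → r y z → x ≤ y

namespace IsPlaneOrder

variable [PartialOrder V] {r : V → V → Prop}

theorem not_le (h : IsPlaneOrder r) {x y : V} (hxy : r x y) : ¬ y ≤ x := by
  intro hle
  rcases hle.eq_or_lt with rfl | hlt
  · exact h.asymm hxy hxy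
  · exact h.asymm hxy (h.of_lt hlt)

theorem ne (h : IsPlaneOrder r) {x y : V} (hxy : r x y) : x ≠ y := by
  rintro rfl
  exact h.asymm hxy hxy

/-- The mirror image of a traversal. -/
theorem mirror (h : IsPlaneOrder r) :
    IsPlaneOrder fun x y => x < y ∨ (¬ x ≤ y ∧ ¬ y ≤ x ∧ r y x) where
  asymm := by
    rintro x y (h1 | ⟨h1, h2, h3⟩) (h4 | ⟨h4, h5, h6⟩)
    · exact lt_asymm h1 h4
    · exact h5 h1.le
    · exact h2 h4.le
    · exact h.asymm h3 h6
  trans := by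
    rintro x y z (h1 | ⟨h1, h2, h3⟩) (h4 | ⟨h4, h5, h6⟩)
    · exact Or.inl (h1.trans h4)
    · by_cases hxz : x ≤ z
      · exact Or.inl (lt_of_le_of_ne hxz fun hh => h5 (hh ▸ h1.le))
      · refine Or.inr ⟨hxz, fun hh => h5 (hh.trans h1.le), ?_⟩
        rcases h.total (x := x) (y := z) (fun hh => hxz hh.le) with h7 | h7
        · exact absurd (h.interval h1.le h7 h6) hxz
        · exact h7
    · by_cases hzx : z ≤ x
      · exact absurd (h4.le.trans hzx) h2
      · by_cases hxz : x ≤ z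
        · exact Or.inl (lt_of_le_of_ne hxz fun hh => hzx hh.ge)
        · refine Or.inr ⟨hxz, hzx, ?_⟩
          rcases h.total (x := x) (y := z) (fun hh => hxz hh.le) with h7 | h7
          · exact absurd (h.interval h4.le h3 h7) h2
          · exact h7
    · have h7 := h.trans h6 h3
      by_cases hxz : x ≤ z
      · exact absurd hxz (h.not_le h7)
      · refine Or.inr ⟨hxz, fun hh => h4 ?_, h7⟩
        exact absurd (h.interval hh h6 h3) h5
  total := by
    intro x y hne
    by_cases hxy : x ≤ y
    · exact Or.inl (Or.inl (lt_of_le_of_ne hxy hne))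
    by_cases hyx : y ≤ x
    · exact Or.inr (Or.inl (lt_of_le_of_ne hyx hne.symm))
    rcases h.total hne with h1 | h1
    · exact Or.inr (Or.inr ⟨hyx, hxy, h1⟩)
    · exact Or.inl (Or.inr ⟨hxy, hyx, h1⟩)
  of_lt := fun hxy => Or.inl hxy
  interval := by
    rintro x y z hxz (h1 | ⟨h1, h2, h3⟩) (h4 | ⟨h4, h5, h6⟩)
    · exact h1.le
    · exact h1.le
    · exact absurd (h.interval h4.le h3 (h.of_lt (lt_of_le_of_ne hxz fun hh => h2 (hh ▸ h4.le))))
        h2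
    · exact absurd hxz (h.not_le (h.trans h6 h3))

end IsPlaneOrder

namespace IsTreeOrder

variable [PartialOrder V] {D : Digraph V}

/-- The hexagon has sources z, x, y and sinks p, b, a; two of its sides are z ⇝ p and z ⇝ q → a. The
tree paths meet only in z because z is the meet of p and q. A vertex not above z is on neither path,
whence the conditional hypotheses. -/
theorem hasHexagon_fork (hT : D.IsTreeOrder) {z p q a b x y : V} (hzp : z < p) (hzq : z < q)
    (hz : ∀ w, w ≤ p → w ≤ q → w ≤ z)
    (hxp : D.Adj x p) (hxb : D.Adj x b) (hyb : D.Adj y b) (hya : D.Adj y a) (hqa : D.Adj q a)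
    (hxy : x ≠ y) (hab : a ≠ b) (hxa : x ≠ a)
    (ha : z ≤ a → ¬ a ≤ p ∧ ¬ a ≤ q) (hb : z ≤ b → ¬ b ≤ p ∧ ¬ b ≤ q)
    (hx : z ≤ x → ¬ x ≤ p ∧ ¬ x ≤ q) (hy : z ≤ y → ¬ y ≤ p ∧ ¬ y ≤ q) : D.HasHexagon := by
  have h1 := hT.ne hxp
  have h2 := hT.ne hxb
  have h3 := hT.ne hyb
  have h4 := hT.ne hya
  have hpq : ¬ p ≤ q := fun h => hzp.not_ge (hz p le_rfl h)
  refine hasHexagon_of_fork (a := z) (x := p) (b := x) (y := b) (c := y) (z := a) ?_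
    (hT.reach hzp.le) (hT.reach_snoc hzq.le hqa fun h => (ha h).2) hxp hxb hyb hya ?_ ?_ ?_
  all_goals simp only [List.nodup_cons, List.mem_cons, List.not_mem_nil, or_false, not_or,
    Set.mem_ofPred_eq, List.nodup_nil]
  · grind
  · grind
  · grind
  · grind

end IsTreeOrder

/-! ### Cross arcs -/

/-- `E` consists of arcs of `D` between incomparable vertices, from right to left. -/
structure IsCross [PartialOrder V] (D : Digraph V) (r E : V → V → Prop) : Prop where
  adj : ∀ {y b}, E y b → D.Adj y b
  left : ∀ {y b}, E y b → r b y
  incomp : ∀ {y b}, E y b → ¬ b ≤ y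

section

variable [PartialOrder V] {D : Digraph V} {r E F : V → V → Prop}

theorem IsCross.mono (h : IsCross D r E) (hF : ∀ {y b}, F y b → E y b) : IsCross D r F :=
  ⟨fun h' => h.adj (hF h'), fun h' => h.left (hF h'), fun h' => h.incomp (hF h')⟩

theorem IsTreeOrder.hasHexagon_cross (hT : D.IsTreeOrder) {p q a b x y : V}
    (hpq : ¬ p ≤ q) (hqp : ¬ q ≤ p)
    (hxp : D.Adj x p) (hxb : D.Adj x b) (hyb : D.Adj y b) (hya : D.Adj y a) (hqa : D.Adj q a)
    (hxy : x ≠ y) (hab : a ≠ b) (hxa : x ≠ a)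
    (ha : ¬ a ≤ p ∧ ¬ a ≤ q) (hb : ¬ b ≤ p ∧ ¬ b ≤ q)
    (hx : ¬ x ≤ p ∧ ¬ x ≤ q) (hy : ¬ y ≤ p ∧ ¬ y ≤ q) : D.HasHexagon := by
  obtain ⟨z, hzp, hzq, hz⟩ := hT.inf p q
  exact hT.hasHexagon_fork (lt_of_le_of_ne hzp fun h => hpq (h ▸ hzq))
    (lt_of_le_of_ne hzq fun h => hqp (h ▸ hzp)) hz hxp hxb hyb hya hqa hxy hab hxa
    (fun _ => ha) (fun _ => hb) (fun _ => hx) (fun _ => hy)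

/-- An arc y → b surviving four peelings comes with p, b, a, q, y, x in increasing traversal order
and arcs x → p, x → b, y → b, y → a, q → a. If p or b were below q, the interval property would put
it below b or a respectively, two out-neighbours of one vertex; hence the fork at the meet of p and
q works. -/
theorem IsCross.sparse_of_out_antichain (hE : IsCross D r E) (hT : D.IsTreeOrder)
    (hr : IsPlaneOrder r) (hfree : ¬ D.HasHexagon)
    (hout : ∀ {y a b}, E y a → E y b → b ≤ a → b = a) : Sparse 4 E := by
  refine Sparse.peel_out (fun b a => r a b) (fun y b b' _ _ h => (hr.total h).symm) (k := 3) ?_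
  refine Sparse.peel_in (fun y x => r x y) (fun y y' b _ _ h => (hr.total h).symm) (k := 2) ?_
  refine Sparse.peel_out r (fun y b b' _ _ h => hr.total h) (k := 1) ?_
  refine Sparse.peel_in r (fun y b b' _ _ h => hr.total h) (k := 0) (sparse_zero ?_)
  rintro y b ⟨⟨⟨⟨hyb, -⟩, -⟩, a, ⟨⟨hya, -⟩, q, ⟨hqa, -⟩, hqy⟩, hba⟩, x,
    ⟨⟨⟨hxb, p, hxp, hpb⟩, -⟩, -⟩, hyx⟩
  have haq := hE.left hqa
  have hpq := hr.trans (hr.trans hpb hba) haq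
  have hpy := hr.trans hpq hqy
  have hqx := hr.trans hqy hyx
  refine hfree (hT.hasHexagon_cross (p := p) (q := q) (a := a) (b := b) (x := x) (y := y)
    ?_ (hr.not_le hpq) (hE.adj hxp) (hE.adj hxb) (hE.adj hyb) (hE.adj hya) (hE.adj hqa)
    (hr.ne hyx).symm (hr.ne hba).symm (hr.ne (hr.trans haq hqx)).symm
    ⟨hr.not_le (hr.trans hpb hba), hE.incomp hqa⟩ ⟨hr.not_le hpb, ?_⟩
    ⟨hr.not_le (hr.trans hpy hyx), hr.not_le hqx⟩ ⟨hr.not_le hpy, hr.not_le hqy⟩)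
  · intro h
    exact hr.ne hpb (hout hxb hxp (hr.interval h hpb (hr.trans hba haq)))
  · intro h
    exact hr.ne hba (hout hya hyb (hr.interval h hba haq))

/-- The minimal out-neighbours of a vertex form an antichain, so removing the arcs to them costs 4,
and survivors gain a witness in the tree order instead of the traversal. -/
theorem IsCross.sparse_top (hE : IsCross D r E) (hT : D.IsTreeOrder)
    (hr : IsPlaneOrder r) (hfree : ¬ D.HasHexagon) {k : ℕ}
    (h : Sparse k fun y b => E y b ∧ ∃ a, E y a ∧ a < b) : Sparse (4 + k) E := by
  refine Sparse.split _ (IsCross.sparse_of_out_antichain (hE.mono fun h => h.1) hT hr hfree ?_) h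
  rintro y a b ⟨h1, h2⟩ ⟨h3, h4⟩ hle
  by_contra hne
  exact h2 ⟨b, h3, lt_of_le_of_ne hle hne⟩

theorem IsCross.sparse_bot (hE : IsCross D r E) (hT : D.IsTreeOrder)
    (hr : IsPlaneOrder r) (hfree : ¬ D.HasHexagon) {k : ℕ}
    (h : Sparse k fun y b => E y b ∧ ∃ a, E y a ∧ b < a) : Sparse (4 + k) E := by
  refine Sparse.split _ (IsCross.sparse_of_out_antichain (hE.mono fun h => h.1) hT hr hfree ?_) h
  rintro y a b ⟨h1, h2⟩ ⟨h3, h4⟩ hle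
  by_contra hne
  exact h4 ⟨a, h1, lt_of_le_of_ne hle hne⟩

/-- The heads now form a tree chain p < b < a, while the tails x, y, w are ordered by the traversal;
the fork is at the meet of p and w. -/
theorem IsCross.sparse_of_in_antichain (hE : IsCross D r E) (hT : D.IsTreeOrder)
    (hr : IsPlaneOrder r) (hfree : ¬ D.HasHexagon)
    (hin : ∀ {x y b}, E x b → E y b → x ≤ y → x = y) : Sparse 10 E := by
  refine hE.sparse_top hT hr hfree (k := 6) ?_
  refine Sparse.peel_in (fun y x => r x y) (fun y y' b _ _ h => (hr.total h).symm) (k := 5) ?_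
  refine IsCross.sparse_top (r := r) (hE.mono fun h => h.1.1) hT hr hfree (k := 1) ?_
  refine Sparse.peel_in r (fun y b b' _ _ h => hr.total h) (k := 0) (sparse_zero ?_)
  rintro y a ⟨⟨⟨⟨hya, -⟩, -⟩, b, ⟨⟨hyb, -⟩, x, ⟨hxb, p, hxp, hpb⟩, hxy⟩, hba⟩, w,
    ⟨⟨⟨hwa, -⟩, -⟩, -⟩, hyw⟩
  have hxw := hr.trans hxy hyw
  refine hfree (hT.hasHexagon_cross (p := p) (q := w) (a := a) (b := b) (x := x) (y := y)
    ?_ ?_ (hE.adj hxp) (hE.adj hxb) (hE.adj hyb) (hE.adj hya) (hE.adj hwa)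
    (hr.ne hxy) hba.ne' ?_ ⟨(hpb.trans hba).not_ge, hE.incomp hwa⟩ ⟨hpb.not_ge, ?_⟩
    ⟨?_, ?_⟩ ⟨?_, ?_⟩)
  · exact fun h => hE.incomp hxp (hr.interval h (hE.left hxp) hxw)
  · exact fun h => hr.not_le (hE.left hwa) (h.trans (hpb.trans hba).le)
  · exact fun h => hE.incomp hxb (h ▸ hba.le)
  · exact fun h => hE.incomp hyb (hr.interval h (hE.left hyb) hyw)
  · exact hr.not_le (hE.left hxp)
  · exact fun h => hr.ne hxy (hin hxb hyb (hr.interval h hxy hyw))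
  · exact fun h => hr.not_le (hE.left hyb) (h.trans hpb.le)
  · exact fun h => hr.ne hyw (hin hya hwa h)

theorem IsCross.sparse_in_top (hE : IsCross D r E) (hT : D.IsTreeOrder)
    (hr : IsPlaneOrder r) (hfree : ¬ D.HasHexagon) {k : ℕ}
    (h : Sparse k fun y b => E y b ∧ ∃ x, E x b ∧ x < y) : Sparse (10 + k) E := by
  refine Sparse.split _ (IsCross.sparse_of_in_antichain (hE.mono fun h => h.1) hT hr hfree ?_) h
  rintro x y b ⟨h1, h2⟩ ⟨h3, h4⟩ hle
  by_contra hne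
  exact h4 ⟨x, h1, lt_of_le_of_ne hle hne⟩

theorem IsCross.sparse_in_bot (hE : IsCross D r E) (hT : D.IsTreeOrder)
    (hr : IsPlaneOrder r) (hfree : ¬ D.HasHexagon) {k : ℕ}
    (h : Sparse k fun y b => E y b ∧ ∃ x, E x b ∧ y < x) : Sparse (10 + k) E := by
  refine Sparse.split _ (IsCross.sparse_of_in_antichain (hE.mono fun h => h.1) hT hr hfree ?_) h
  rintro x y b ⟨h1, h2⟩ ⟨h3, h4⟩ hle
  by_contra hne
  exact h2 ⟨y, h3, lt_of_le_of_ne hle hne⟩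

/-- Here 28 = 4 + 10 + 4 + 10. A survivor yields two tree chains, p < b < a of heads and q < y < x
of tails, and a fork at the meet of p and q. -/
theorem IsCross.sparse (hE : IsCross D r E) (hT : D.IsTreeOrder)
    (hr : IsPlaneOrder r) (hfree : ¬ D.HasHexagon) : Sparse 28 E := by
  refine hE.sparse_top hT hr hfree (k := 24) ?_
  refine IsCross.sparse_in_top (r := r) (hE.mono fun h => h.1) hT hr hfree (k := 14) ?_
  refine IsCross.sparse_bot (r := r) (hE.mono fun h => h.1.1) hT hr hfree (k := 10) ?_
  refine IsCross.sparse_in_bot (r := r) (hE.mono fun h => h.1.1.1) hT hr hfree (k := 0)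
    (sparse_zero ?_)
  rintro y b ⟨⟨⟨⟨hyb, -⟩, -⟩, a, ⟨⟨hya, -⟩, q, ⟨hqa, -⟩, hqy⟩, hba⟩, x,
    ⟨⟨⟨hxb, p, hxp, hpb⟩, -⟩, -⟩, hyx⟩
  have hqx := hqy.trans hyx
  refine hfree (hT.hasHexagon_cross (p := p) (q := q) (a := a) (b := b) (x := x) (y := y)
    ?_ ?_ (hE.adj hxp) (hE.adj hxb) (hE.adj hyb) (hE.adj hya) (hE.adj hqa)
    hyx.ne' hba.ne' ?_ ⟨(hpb.trans hba).not_ge, hE.incomp hqa⟩ ⟨hpb.not_ge, ?_⟩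
    ⟨hr.not_le (hE.left hxp), hqx.not_ge⟩ ⟨?_, hqy.not_ge⟩)
  · exact fun h => hE.incomp hxp (h.trans hqx.le)
  · exact fun h => hr.not_le (hE.left hqa) (h.trans (hpb.trans hba).le)
  · exact fun h => hr.not_le (hE.left hya) (h ▸ hyx.le)
  · exact fun h => hE.incomp hyb (h.trans hqy.le)
  · exact fun h => hr.not_le (hE.left hyb) (h.trans hpb.le)

end

/-! ### Back arcs whose tails at a common head are incomparable -/

/-- `E` consists of arcs of `D` from a vertex to a proper ancestor. -/
structure IsBack [PartialOrder V] (D : Digraph V) (E : V → V → Prop) : Prop where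
  adj : ∀ {y b}, E y b → D.Adj y b
  lt : ∀ {y b}, E y b → b < y

section

variable [PartialOrder V] {D : Digraph V} {E F : V → V → Prop}

theorem IsBack.mono (h : IsBack D E) (hF : ∀ {y b}, F y b → E y b) : IsBack D F :=
  ⟨fun h' => h.adj (hF h'), fun h' => h.lt (hF h')⟩

theorem IsTreeOrder.comparable (hT : D.IsTreeOrder) {x y z : V} (hx : x ≤ z) (hy : y ≤ z)
    (hne : x ≠ y) : x < y ∨ y < x :=
  (hT.chain hx hy).imp (fun h => lt_of_le_of_ne h hne) fun h => lt_of_le_of_ne h hne.symm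

/-- A set of backward arcs is sparse if the tails of the arcs with the same head lie in
different branches at that head. -/
theorem IsBack.sparse_one_of_branch (hE : IsBack D E) (hT : D.IsTreeOrder)
    (h : ∀ {y y' b c}, E y b → E y' b → b < c → c ≤ y → c ≤ y' → y = y') : Sparse 1 E := by
  classical
  refine sparse_one_of_injOn fun S => ?_
  -- The arc (y, b) is charged to the first vertex u of `S` after b on the way to y. From u one
  -- recovers b as the last vertex of `S` before u, and then y from the branch.
  have hmin : ∀ e : V × V, ∃ u, e.1 ∈ S → E e.1 e.2 →
      (u ∈ S ∧ e.2 < u ∧ u ≤ e.1) ∧ ∀ w ∈ S, e.2 < w → ¬ w < u := by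
    rintro ⟨y, b⟩
    by_cases hy : y ∈ S ∧ E y b
    · obtain ⟨u, hu, hmin⟩ := (S.filter fun u => b < u ∧ u ≤ y).exists_minimal
        ⟨y, Finset.mem_filter.2 ⟨hy.1, hE.lt hy.2, le_rfl⟩⟩
      rw [Finset.mem_filter] at hu
      refine ⟨u, fun _ _ => ⟨hu, fun w hw hbw hwu => ?_⟩⟩
      exact hwu.not_ge (hmin (Finset.mem_filter.2 ⟨hw, hbw, hwu.le.trans hu.2.2⟩) hwu.le)
    · exact ⟨y, fun h1 h2 => absurd ⟨h1, h2⟩ hy⟩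
  choose g hg using hmin
  refine ⟨g, fun y hy b _ hyb => (hg (y, b) hy hyb).1.1, ?_⟩
  intro y hy b hb y' hy' b' hb' hyb hyb' heq
  obtain ⟨⟨-, h1, h2⟩, h3⟩ := hg (y, b) hy hyb
  obtain ⟨⟨-, h1', h2'⟩, h3'⟩ := hg (y', b') hy' hyb'
  rw [← heq] at h1' h2' h3'
  have hbb : b = b' := by
    by_contra hne
    rcases hT.comparable h1.le h1'.le hne with h4 | h4
    · exact h3 b' hb' h4 h1'
    · exact h3' b hb h4 h1
  subst hbb
  exact ⟨h hyb hyb' h1 h2 h2', rfl⟩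

/-- An arc is removed when no arc from the same branch to the same head beats its tail under `s`.
Totality of `s` leaves at most one such arc per branch. -/
theorem IsBack.peel_branch (hE : IsBack D E) (hT : D.IsTreeOrder) {s : V → V → Prop}
    (hs : ∀ {x y}, x ≠ y → s x y ∨ s y x) {k : ℕ}
    (h : Sparse k fun y b => E y b ∧ ∃ w c, E w b ∧ b < c ∧ c ≤ y ∧ c ≤ w ∧ s y w) :
    Sparse (1 + k) E := by
  refine Sparse.split _ (IsBack.sparse_one_of_branch (hE.mono fun h => h.1) hT ?_) h
  rintro y y' b c ⟨h1, h2⟩ ⟨h3, h4⟩ hbc hcy hcy'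
  by_contra hne
  rcases hs hne with h5 | h5
  · exact h2 ⟨y', c, h3, hbc, hcy, hcy', h5⟩
  · exact h4 ⟨y, c, h1, hbc, hcy', hcy, h5⟩

theorem IsBack.peel_low (hE : IsBack D E) (hT : D.IsTreeOrder) {k : ℕ}
    (h : Sparse k fun y b => E y b ∧ ∃ a, E y a ∧ b < a) : Sparse (1 + k) E :=
  Sparse.peel_out (fun b a => b < a)
    (fun _ _ _ h1 h2 hne => hT.comparable (hE.lt h1).le (hE.lt h2).le hne) h

theorem IsTreeOrder.hasHexagon_fork_direct (hT : D.IsTreeOrder) {z a p b y v : V}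
    (hza : z < a) (hzp : z < p) (hz : ∀ w, w ≤ a → w ≤ p → w ≤ z)
    (hya : D.Adj y a) (hyb : D.Adj y b) (hvb : D.Adj v b) (hvp : D.Adj v p) (hyv : y ≠ v)
    (hyp : y ≠ p) (hva : v ≠ a)
    (hb : z ≤ b → ¬ b ≤ a ∧ ¬ b ≤ p) (hy : z ≤ y → ¬ y ≤ a ∧ ¬ y ≤ p)
    (hv : z ≤ v → ¬ v ≤ a ∧ ¬ v ≤ p) : D.HasHexagon := by
  have h1 := hT.ne hya
  have h2 := hT.ne hyb
  have h3 := hT.ne hvb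
  have h4 := hT.ne hvp
  have hap : ¬ a ≤ p := fun h => hza.not_ge (hz a le_rfl h)
  have hpa : ¬ p ≤ a := fun h => hzp.not_ge (hz p h le_rfl)
  refine hasHexagon_of_fork (a := z) (x := a) (b := y) (y := b) (c := v) (z := p) ?_
    (hT.reach hza.le) (hT.reach hzp.le) hya hyb hvb hvp ?_ ?_ ?_
  all_goals simp only [List.nodup_cons, List.mem_cons, List.not_mem_nil, or_false, not_or,
    Set.mem_ofPred_eq, List.nodup_nil]
  · grind
  · grind
  · grind
  · exact fun v h1 h2 => h1.1.not_ge (hz v h1.2.le h2.2.le)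

theorem IsTreeOrder.hasHexagon_fork_both (hT : D.IsTreeOrder) {z w x a p b y v : V}
    (hzw : z < w) (hzx : z < x) (hz : ∀ u, u ≤ w → u ≤ x → u ≤ z)
    (hwa : D.Adj w a) (hxp : D.Adj x p)
    (hya : D.Adj y a) (hyb : D.Adj y b) (hvb : D.Adj v b) (hvp : D.Adj v p) (hyv : y ≠ v)
    (hyp : y ≠ p) (hva : v ≠ a) (hap : a ≠ p) (hab : a ≠ b) (hbp : b ≠ p)
    (haz : a < z) (hbz : b < z) (hpz : p < z)
    (hy : z ≤ y → ¬ y ≤ w ∧ ¬ y ≤ x) (hv : z ≤ v → ¬ v ≤ w ∧ ¬ v ≤ x) : D.HasHexagon := by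
  have h1 := hT.ne hya
  have h2 := hT.ne hyb
  have h3 := hT.ne hvb
  have h4 := hT.ne hvp
  refine hasHexagon_of_fork (a := z) (x := a) (b := y) (y := b) (c := v) (z := p) ?_
    (hT.reach_snoc hzw.le hwa fun h => absurd haz h.not_gt)
    (hT.reach_snoc hzx.le hxp fun h => absurd hpz h.not_gt) hya hyb hvb hvp ?_ ?_ ?_
  all_goals simp only [List.nodup_cons, List.mem_cons, List.not_mem_nil, or_false, not_or,
    Set.mem_ofPred_eq, List.nodup_nil]
  · grind
  · grind
  · grind
  · exact fun v h1 h2 => h1.1.not_ge (hz v h1.2 h2.2)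

variable {r : V → V → Prop}

/-- Were a and p incomparable, their meet would lie strictly above b because y and v share a branch
there; tree paths from the meet to a and p, with the arcs of y and v, then form a hexagon. -/
theorem IsBack.comparable_of_branch (hE : IsBack D E) (hT : D.IsTreeOrder)
    (hfree : ¬ D.HasHexagon) (hin : ∀ {x y b}, E x b → E y b → x ≤ y → x = y)
    {y v a p b c : V} (hyv : y ≠ v) (hyb : E y b) (hvb : E v b) (hbc : b < c) (hcy : c ≤ y)
    (hcv : c ≤ v) (hya : E y a) (hvp : E v p) : a ≤ p ∨ p ≤ a := by
  by_contra hcon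
  push Not at hcon
  obtain ⟨z, hza, hzp, hz⟩ := hT.inf a p
  have hay := hE.lt hya
  have hpv := hE.lt hvp
  have hyv' : ¬ y ≤ v := fun h => hyv (hin hyb hvb h)
  have hvy' : ¬ v ≤ y := fun h => hyv (hin hvb hyb h).symm
  have hbz : b < z := by
    rcases hT.chain hcy hay.le with h1 | h1
    · rcases hT.chain hcv hpv.le with h2 | h2
      · exact hbc.trans_le (hz c h1 h2)
      · exact absurd (h2.trans h1) hcon.2
    · rcases hT.chain (h1.trans hcv) hpv.le with h2 | h2
      · exact absurd h2 hcon.1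
      · exact absurd h2 hcon.2
  refine hfree (hT.hasHexagon_fork_direct (z := z) (a := a) (p := p) (b := b) (y := y) (v := v)
    (lt_of_le_of_ne hza fun h => hcon.1 (h ▸ hzp)) (lt_of_le_of_ne hzp fun h => hcon.2 (h ▸ hza))
    hz (hE.adj hya) (hE.adj hyb) (hE.adj hvb) (hE.adj hvp) hyv
    (fun h => hyv' (h ▸ hpv.le)) (fun h => hvy' (h ▸ hay.le))
    (fun h => absurd hbz h.not_gt) (fun _ => ⟨hay.not_ge, fun h => hyv' (h.trans hpv.le)⟩)
    (fun _ => ⟨fun h => hvy' (h.trans hay.le), hpv.not_ge⟩))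

theorem IsBack.hasHexagon_of_left_right (hE : IsBack D E) (hT : D.IsTreeOrder)
    (hr : IsPlaneOrder r) (hin : ∀ {x y b}, E x b → E y b → x ≤ y → x = y)
    {y v b p p₃ a₁ a₂ x w c d : V} (hyv : r y v) (hyb : E y b) (hvb : E v b) (hya₁ : E y a₁)
    (hya₂ : E y a₂) (hvp : E v p) (hvp₃ : E v p₃) (hbp : b < p) (hpa : p < a₁) (haa : a₁ < a₂)
    (hpp₃ : p < p₃) (hcomp : a₁ ≤ p₃ ∨ p₃ ≤ a₁)
    (hxp : E x p) (hvx : r v x) (hpc : p < c) (hcv : c ≤ v) (hcx : c ≤ x)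
    (hwa : E w a₁) (hwy : r w y) (had : a₁ < d) (hdy : d ≤ y) (hdw : d ≤ w) : D.HasHexagon := by
  have ha₂y := hE.lt hya₂
  have hyx := hr.trans hyv hvx
  have hvy' : ¬ v ≤ y := hr.not_le hyv
  have hyv' : ¬ y ≤ v := fun h => hr.ne hyv (hin hyb hvb h)
  have hvx' : ¬ v ≤ x := fun h => hr.ne hvx (hin hvp hxp h)
  obtain ⟨m, hpm, hma, hmp⟩ : ∃ m, p < m ∧ m ≤ a₁ ∧ m ≤ p₃ := by
    rcases hcomp with h | h
    · exact ⟨a₁, hpa, le_rfl, h⟩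
    · exact ⟨p₃, hpp₃, h, le_rfl⟩
  -- The vertex e lies below both a₁ and x, which forces the meet of a₂ and x strictly above p.
  obtain ⟨e, hpe, hem, hec⟩ : ∃ e, p < e ∧ e ≤ m ∧ e ≤ c := by
    rcases hT.chain (hmp.trans (hE.lt hvp₃).le) hcv with h | h
    · exact ⟨m, hpm, le_rfl, h⟩
    · exact ⟨c, hpc, h, le_rfl⟩
  -- If a₂ ≤ x, the meet z of w and x is above a₁, and the fork is z ⇝ w → a₁ with z ⇝ x → p.
  -- Otherwise z is the meet of a₂ and x, and the fork is z ⇝ a₂ with z ⇝ x → p.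
  by_cases hax : a₂ ≤ x
  · obtain ⟨f, haf, hfd, hfa⟩ : ∃ f, a₁ < f ∧ f ≤ d ∧ f ≤ a₂ := by
      rcases hT.chain hdy ha₂y.le with h | h
      · exact ⟨d, had, le_rfl, h⟩
      · exact ⟨a₂, haa, h, le_rfl⟩
    obtain ⟨z, hzw, hzx, hz⟩ := hT.inf w x
    have haz : a₁ < z := haf.trans_le (hz f (hfd.trans hdw) (hfa.trans hax))
    have hwx := hr.trans hwy hyx
    have hwx' : ¬ w ≤ x := fun h => hr.ne hwy (hin hwa hya₁ (hr.interval h hwy hyx))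
    refine hT.hasHexagon_fork_both (z := z) (w := w) (x := x) (a := a₁) (p := p) (b := b)
      (y := y) (v := v) (lt_of_le_of_ne hzw fun h => hwx' (h ▸ hzx))
      (lt_of_le_of_ne hzx fun h => hr.not_le hwx (h ▸ hzw)) hz (hE.adj hwa) (hE.adj hxp)
      (hE.adj hya₁) (hE.adj hyb) (hE.adj hvb) (hE.adj hvp) (hr.ne hyv)
      (fun h => hyv' (h ▸ (hE.lt hvp).le)) (fun h => hvy' (h ▸ (hE.lt hya₁).le)) hpa.ne'
      (hbp.trans hpa).ne' hbp.ne haz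
      (hbp.trans (hpa.trans haz)) (hpa.trans haz)
      (fun _ => ⟨hr.not_le hwy, fun h => hyv' (hr.interval h hyv hvx)⟩)
      (fun _ => ⟨hr.not_le (hr.trans hwy hyv), hvx'⟩)
  · obtain ⟨z, hzx, hza, hz⟩ := hT.inf a₂ x
    have hpz : p < z := hpe.trans_le (hz e ((hem.trans hma).trans haa.le) (hec.trans hcx))
    refine hT.hasHexagon_fork (z := z) (p := a₂) (q := x) (a := p) (b := b) (x := y) (y := v)
      (lt_of_le_of_ne hzx fun h => hax (h ▸ hza))
      (lt_of_le_of_ne hza fun h => hr.not_le hyx ((h ▸ hzx).trans ha₂y.le)) hz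
      (hE.adj hya₂) (hE.adj hyb) (hE.adj hvb) (hE.adj hvp) (hE.adj hxp) (hr.ne hyv) hbp.ne'
      (fun h => hyv' (h ▸ (hE.lt hvp).le)) (fun h => absurd hpz h.not_gt)
      (fun h => absurd (hbp.trans hpz) h.not_gt)
      (fun _ => ⟨ha₂y.not_ge, fun h => hax (ha₂y.le.trans h)⟩)
      (fun _ => ⟨fun h => hvy' (h.trans ha₂y.le), hvx'⟩)

/-- Here 6 = 1 + 1 + 3 + 1. Two branch peelings supply rival tails on either side, three low
peelings supply chains of higher out-neighbours, and the last branch peeling supplies the pair y, v.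
-/
theorem IsBack.sparse_of_in_antichain (hE : IsBack D E) (hT : D.IsTreeOrder)
    (hr : IsPlaneOrder r) (hfree : ¬ D.HasHexagon)
    (hin : ∀ {x y b}, E x b → E y b → x ≤ y → x = y) : Sparse 6 E := by
  refine hE.peel_branch hT (s := fun y w => r w y) (fun h => (hr.total h).symm) (k := 5) ?_
  set E₁ : V → V → Prop := fun y b => E y b ∧ ∃ w c, E w b ∧ b < c ∧ c ≤ y ∧ c ≤ w ∧ r w y with hE₁
  have h1 : ∀ {y b}, E₁ y b → E y b := fun h => h.1
  refine (hE.mono h1).peel_branch hT (s := r) hr.total (k := 4) ?_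
  set E₂ : V → V → Prop := fun y b => E₁ y b ∧ ∃ w c, E₁ w b ∧ b < c ∧ c ≤ y ∧ c ≤ w ∧ r y w
    with hE₂
  have h2 : ∀ {y b}, E₂ y b → E y b := fun h => h1 h.1
  have hleft : ∀ {y b}, E₂ y b → ∃ w c, E w b ∧ b < c ∧ c ≤ y ∧ c ≤ w ∧ r w y := fun h => h.1.2
  have hright : ∀ {y b}, E₂ y b → ∃ w c, E w b ∧ b < c ∧ c ≤ y ∧ c ≤ w ∧ r y w := fun h => by
    obtain ⟨w, c, h3, h4⟩ := h.2
    exact ⟨w, c, h1 h3, h4⟩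
  clear_value E₂
  refine (hE.mono h2).peel_low hT (k := 3) ?_
  refine IsBack.peel_low (hE.mono fun h => h2 h.1) hT (k := 2) ?_
  refine IsBack.peel_low (hE.mono fun h => h2 h.1.1) hT (k := 1) ?_
  refine IsBack.peel_branch (hE.mono fun h => h2 h.1.1.1) hT (s := r) hr.total (k := 0)
    (sparse_zero ?_)
  rintro y b ⟨⟨⟨⟨hyb, -⟩, -⟩, a₁, ⟨⟨hya₁, -⟩, a₂, ⟨hya₂, a₃, hya₃, h23⟩, h12⟩, hb1⟩, v, c,
    ⟨⟨⟨hvb, -⟩, -⟩, p₁, ⟨⟨hvp₁, -⟩, p₂, ⟨hvp₂, p₃, hvp₃, g23⟩, g12⟩, gb1⟩, hbc, hcy, hcv, hyv⟩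
  have hcomp : ∀ {a p}, E₂ y a → E₂ v p → a ≤ p ∨ p ≤ a := fun hya hvp =>
    hE.comparable_of_branch hT hfree hin (hr.ne hyv) (h2 hyb) (h2 hvb) hbc hcy hcv (h2 hya)
      (h2 hvp)
  -- a₁ coincides with at most one of p₁ and p₂, and p₃ stays above the other.
  obtain ⟨p, hvp, hbp, hpp₃, hne⟩ : ∃ p, E₂ v p ∧ b < p ∧ p < p₃ ∧ a₁ ≠ p := by
    by_cases h : a₁ = p₁
    · exact ⟨p₂, hvp₂, gb1.trans g12, g23, h ▸ g12.ne⟩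
    · exact ⟨p₁, hvp₁, gb1, g12.trans g23, h⟩
  rcases hcomp hya₁ hvp with h3 | h3
  · have hlt := lt_of_le_of_ne h3 hne
    obtain ⟨x, d, hx, hd1, hd2, hd3, hd4⟩ := hleft hya₁
    obtain ⟨w, e, hw, he1, he2, he3, he4⟩ := hright hvp
    -- Tails of a common head are incomparable, so the mirrored traversal reverses them; this case
    -- is the other one with y and v exchanged.
    have hm : ∀ {u t q}, E u q → E t q → r u t → t < u ∨ ¬ t ≤ u ∧ ¬ u ≤ t ∧ r u t :=
      fun hu ht h => Or.inr ⟨hr.not_le h, fun hh => hr.ne h (hin hu ht hh), h⟩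
    exact hfree (hE.hasHexagon_of_left_right hT hr.mirror hin (hm (h2 hyb) (h2 hvb) hyv) (h2 hvb)
      (h2 hyb) (h2 hvp) (h2 hvp₃) (h2 hya₁) (h2 hya₂) hb1 hlt hpp₃ h12 (hcomp hya₂ hvp).symm hx
      (hm hx (h2 hya₁) hd4) hd1 hd2 hd3 hw (hm (h2 hvp) hw he4) he1 he2 he3)
  · obtain ⟨x, d, hx, hd1, hd2, hd3, hd4⟩ := hright hvp
    obtain ⟨w, e, hw, he1, he2, he3, he4⟩ := hleft hya₁
    exact hfree (hE.hasHexagon_of_left_right hT hr hin hyv (h2 hyb) (h2 hvb) (h2 hya₁) (h2 hya₂)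
      (h2 hvp) (h2 hvp₃) hbp (lt_of_le_of_ne h3 hne.symm) h12 hpp₃
      (hcomp hya₁ hvp₃) hx hd4 hd1 hd2 hd3 hw he4 he1 he2 he3)

end

theorem ReachVia.mono {D : Digraph V} {S T : Set V} {x y : V} (h : D.ReachVia S x y)
    (hST : ∀ v ∈ S, v ∈ T) :
    D.ReachVia T x y := by
  obtain ⟨p, hp, hv⟩ := h
  exact ⟨p, hp, fun v hvp => (hv v hvp).imp_right (Or.imp_right (hST v))⟩

/-! ### Back arcs in general -/

section

variable [PartialOrder V] {D : Digraph V} {r E : V → V → Prop}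

theorem IsBack.peel_in (hE : IsBack D E) (hT : D.IsTreeOrder) (hr : IsPlaneOrder r)
    (hfree : ¬ D.HasHexagon) (P : V → V → Prop) {k : ℕ}
    (hP : ∀ {x y b}, E x b → E y b → ¬ P x b → ¬ P y b → ¬ x < y)
    (h : Sparse k fun y b => E y b ∧ P y b) : Sparse (6 + k) E := by
  refine Sparse.split P
    (IsBack.sparse_of_in_antichain (hE.mono fun h => h.1) hT hr hfree ?_) h
  rintro x y b ⟨h1, h2⟩ ⟨h3, h4⟩ hle
  by_contra hne
  exact hP h1 h3 h2 h4 (lt_of_le_of_ne hle hne)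

theorem IsBack.peel_in_top (hE : IsBack D E) (hT : D.IsTreeOrder) (hr : IsPlaneOrder r)
    (hfree : ¬ D.HasHexagon) {k : ℕ}
    (h : Sparse k fun y b => E y b ∧ ∃ x, E x b ∧ x < y) : Sparse (6 + k) E :=
  hE.peel_in hT hr hfree _ (fun h1 _ _ h4 hlt => h4 ⟨_, h1, hlt⟩) h

theorem IsTreeOrder.hasHexagon_of_nested (hT : D.IsTreeOrder) {a b c d e f : V}
    (hba : D.Adj b a) (hdc : D.Adj d c) (hfe : D.Adj f e) (hfa : D.Adj f a)
    (hab : a < b) (hbc : b < c) (hcd : c < d) (hde : d < e) (hef : e < f) : D.HasHexagon := by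
  refine hasHexagon_of_skip (a := b) (x := c) (b := d) (y := e) (c := f) (z := a) ?_
    (hT.reach hbc.le) (hT.reach hde.le) hdc hfe hfa hba ?_ ?_ ?_
  all_goals simp only [List.nodup_cons, List.mem_cons, List.not_mem_nil, or_false, not_or,
    Set.mem_ofPred_eq, List.nodup_nil]
  all_goals repeat' apply And.intro
  all_goals grind

theorem IsTreeOrder.hasHexagon_of_jump (hT : D.IsTreeOrder) {f g a b c d e : V}
    (hfa : D.Adj f a) (hfb : D.Adj f b) (hga : D.Adj g a) (hge : D.Adj g e) (hdc : D.Adj d c)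
    (hfg : f ≠ g) (hab : a < b) (hbc : b < c) (hcd : c < d) (hde : d < e) (heg : e < g)
    (hfe : ¬ f ≤ e) : D.HasHexagon := by
  have h1 := hT.ne hfa
  refine hasHexagon_of_skip (a := f) (x := c) (b := d) (y := e) (c := g) (z := a) ?_
    (hT.reach_cons hfb hbc.le fun _ h => hfe (h.trans (hcd.trans hde).le)) (hT.reach hde.le)
    hdc hge hga hfa ?_ ?_ ?_
  all_goals simp only [List.nodup_cons, List.mem_cons, List.not_mem_nil, or_false, not_or,
    Set.mem_ofPred_eq, List.nodup_nil]
  all_goals repeat' apply And.intro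
  all_goals grind

/-- The aim is s₀ → t₁ ← s₂ → t₂ ← s₁ → t₀, closed by a path s₀ ⇝ t₀ through σ₀. If that path might
run into s₂, then s₂ ⇝ σ₀ → t₀ is used instead and s₂ → t₂ is replaced by a path s₀ ⇝ t₂ through σ₂.
-/
theorem IsBack.hasHexagon_of_strict (hE : IsBack D E) (hT : D.IsTreeOrder)
    (hstr : ∀ {f a α σ}, E f a → E f α → E σ a → σ ≤ f → α < σ)
    {s₀ s₁ s₂ t₀ t₁ t₂ a α σ₀ σ₂ : V} (h02 : s₀ ≠ s₂) (h01 : s₀ ≠ s₁) (h12 : s₁ ≠ s₂)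
    (hc02 : s₀ ≤ s₂ ∨ s₂ ≤ s₀) (hc12 : s₁ ≤ s₂ ∨ s₂ ≤ s₁)
    (e01 : E s₀ t₁) (e21 : E s₂ t₁) (e2a : E s₂ a) (e22 : E s₂ t₂) (e0α : E s₀ α)
    (e12 : E s₁ t₂) (e10 : E s₁ t₀) (eσ₀ : E σ₀ t₀) (eσ₂ : E σ₂ t₂)
    (hta : t₁ < a) (hat : a < t₀) (htt : t₀ < t₂) (htα : t₂ < α)
    (hσ₀ : σ₀ < s₁) (hσ₂ : σ₂ < s₂) : D.HasHexagon := by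
  have hαs := hE.lt e0α
  have hs2α : ¬ s₂ ≤ α := by
    intro h
    exact (hstr e01 e0α e21 (h.trans hαs.le)).not_ge h
  have h2 := hE.lt e22
  have h10 := hE.lt e12
  by_contra hfree
  -- Otherwise t < σ < α, and the arc σ → t closes the hexagon of `hasHexagon_of_jump`.
  have hjump : ∀ {σ t}, E σ t → a < t → t < α → σ ≤ s₀ → α ≤ σ := by
    intro σ t hσ hat htα hσs
    by_contra hcon
    have hσα : σ < α := lt_of_le_not_ge ((hT.chain hσs hαs.le).resolve_right hcon) hcon
    exact hfree (hT.hasHexagon_of_jump (hE.adj e21) (hE.adj e2a) (hE.adj e01) (hE.adj e0α)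
      (hE.adj hσ) h02.symm hta hat (hE.lt hσ) hσα hαs hs2α)
  -- a path from `s₀` to `t` ending with the arc `(σ, t)`
  have hpath : ∀ {σ t}, E σ t → a < t → t < α → (σ ≤ s₀ ∨ s₀ ≤ σ) →
      D.ReachVia {v | v ≤ σ ∧ α ≤ v ∧ v ≠ s₀} s₀ t := by
    intro σ t hσ hat htα hc
    by_cases h : s₀ ≤ σ
    · exact (hT.reach_snoc h (hE.adj hσ) fun h1 _ => (htα.trans hαs).not_ge h1).mono
        fun v hv => ⟨hv.2, (hαs.trans hv.1).le, hv.1.ne'⟩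
    · have h1 := hc.resolve_right h
      have h2 := hjump hσ hat htα h1
      exact (hT.reach_cons_snoc (hE.adj e0α) h2 (hE.adj hσ) (fun _ => h)
        (fun h3 => absurd htα h3.not_gt) (htα.trans hαs).ne').mono
        fun v hv => ⟨hv.2, hv.1, fun h3 => h (h3 ▸ hv.2)⟩
  have hat2 := hat.trans htt
  have ht0α := htt.trans htα
  have hcσ : σ₀ ≤ s₂ ∨ s₂ ≤ σ₀ := by
    rcases hc12 with h | h
    · exact Or.inl (hσ₀.le.trans h)
    · exact hT.chain hσ₀.le h
  have hcσ0 : ∀ {σ}, σ < s₂ → σ ≤ s₀ ∨ s₀ ≤ σ := by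
    intro σ h
    rcases hc02 with h3 | h3
    · exact hT.chain h.le h3
    · exact Or.inl (h.le.trans h3)
  -- In the first case the path through σ₀ stays above s₀ > s₂ or below s₂. In the second s₂ ≤ σ₀,
  -- and the two long paths are disjoint: one lies above s₂, the other below σ₂ < s₂.
  by_cases hs : s₀ ≤ σ₀ ∧ s₂ < s₀ ∨ σ₀ < s₂
  · have hr : D.ReachVia {v | v ≤ σ₀ ∧ α ≤ v ∧ v ≠ s₀ ∧ v ≠ s₂} s₀ t₀ := by
      rcases hs with ⟨h3, h4⟩ | h3
      · exact (hT.reach_snoc h3 (hE.adj eσ₀) fun h1 _ => (ht0α.trans hαs).not_ge h1).mono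
          fun v hv => ⟨hv.2, (hαs.trans hv.1).le, hv.1.ne', (h4.trans hv.1).ne'⟩
      · exact (hpath eσ₀ hat ht0α (hcσ0 h3)).mono
          fun v hv => ⟨hv.1, hv.2.1, hv.2.2, (hv.1.trans_lt h3).ne⟩
    have hne := hT.ne (hE.adj e12)
    have hne' := hT.ne (hE.adj e10)
    refine hfree (hasHexagon_of_fork (a := s₀) (x := t₀) (b := s₁) (y := t₂) (c := s₂) (z := t₁)
      ?_ hr (.of_adj (hE.adj e01) (hT.ne (hE.adj e01))) (hE.adj e10) (hE.adj e12) (hE.adj e22)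
      (hE.adj e21) ?_ ?_ ?_)
    all_goals clear hpath hjump hstr
    all_goals simp only [List.nodup_cons, List.mem_cons, List.not_mem_nil, or_false, not_or,
      Set.mem_ofPred_eq, List.nodup_nil, Set.mem_empty_iff_false]
    · repeat' apply And.intro
      all_goals grind
    · grind
    · grind
    · grind
  · push Not at hs
    have h3 : s₂ ≤ σ₀ := hcσ.elim (fun h => by
      by_contra h4
      exact hs.2 (lt_of_le_not_ge h h4)) id
    have hr : D.ReachVia {v | s₂ < v ∧ v ≤ σ₀} s₂ t₀ :=
      hT.reach_snoc h3 (hE.adj eσ₀) fun h1 _ => (htt.trans h2).not_ge h1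
    refine hfree (hasHexagon_of_opposite (a := s₂) (x := t₀) (b := s₁) (y := t₂) (c := s₀)
      (z := t₁) ?_ hr (hpath eσ₂ hat2 htα (hcσ0 hσ₂)) (hE.adj e10) (hE.adj e12)
      (hE.adj e01) (hE.adj e21) ?_ ?_ ?_)
    all_goals clear hpath hjump hstr
    all_goals simp only [List.nodup_cons, List.mem_cons, List.not_mem_nil, or_false, not_or,
      Set.mem_ofPred_eq, List.nodup_nil]
    · repeat' apply And.intro
      all_goals grind
    · grind
    · grind
    · grind

/-- Here 28 = 6 + 6 + 4 + 6 + 6: lower tails σ, the partner s₁, four higher out-neighbours, and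
three comparable tails of one head. -/
theorem IsBack.sparse_of_strict (hE : IsBack D E) (hT : D.IsTreeOrder)
    (hr : IsPlaneOrder r) (hfree : ¬ D.HasHexagon)
    (hstr : ∀ {f a α σ}, E f a → E f α → E σ a → σ ≤ f → α < σ) : Sparse 28 E := by
  refine hE.peel_in_top hT hr hfree (k := 22) ?_
  set R : V → V → Prop := fun y b => E y b ∧ ∃ x, E x b ∧ x < y
  have hRE : ∀ {y b}, R y b → E y b := fun h => h.1
  have hRtop : ∀ {y b}, R y b → ∃ x, E x b ∧ x < y := fun h => h.2
  clear_value R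
  -- The partner s₁ has out-neighbours below t reaching at least as high as those of s. Of two
  -- comparable tails of t, one has the other as partner: if both failed, the higher of the two
  -- offending out-neighbours would refute the failure of the tail owning the lower one.
  refine (hE.mono hRE).peel_in hT hr hfree (fun s t => ∃ s₁, s₁ ≠ s ∧ (s₁ ≤ s ∨ s ≤ s₁) ∧
    R s₁ t ∧ ∀ τ, τ < t → R s τ → ∃ t₀, τ ≤ t₀ ∧ t₀ < t ∧ R s₁ t₀) (k := 16) ?_ ?_
  · intro x y t hx hy hnx hny hxy
    push Not at hnx hny
    obtain ⟨τ, h1, h2, h3⟩ := hnx y hxy.ne' (Or.inr hxy.le) hy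
    obtain ⟨τ', h1', h2', h3'⟩ := hny x hxy.ne (Or.inl hxy.le) hx
    rcases hT.chain h1.le h1'.le with h | h
    · exact h3 _ h h1' h2'
    · exact h3' _ h h1 h2
  set P : V → V → Prop := fun s t => R s t ∧ ∃ s₁, s₁ ≠ s ∧ (s₁ ≤ s ∨ s ≤ s₁) ∧
    R s₁ t ∧ ∀ τ, τ < t → R s τ → ∃ t₀, τ ≤ t₀ ∧ t₀ < t ∧ R s₁ t₀
  have hPR : ∀ {y b}, P y b → R y b := fun h => h.1
  have hPpred : ∀ {s t}, P s t → ∃ s₁, s₁ ≠ s ∧ (s₁ ≤ s ∨ s ≤ s₁) ∧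
    R s₁ t ∧ ∀ τ, τ < t → R s τ → ∃ t₀, τ ≤ t₀ ∧ t₀ < t ∧ R s₁ t₀ := fun h => h.2
  clear_value P
  have hPE : ∀ {y b}, P y b → E y b := fun h => hRE (hPR h)
  refine (hE.mono hPE).peel_low hT (k := 15) ?_
  refine IsBack.peel_low (hE.mono fun h => hPE h.1) hT (k := 14) ?_
  refine IsBack.peel_low (hE.mono fun h => hPE h.1.1) hT (k := 13) ?_
  refine IsBack.peel_low (hE.mono fun h => hPE h.1.1.1) hT (k := 12) ?_
  refine IsBack.peel_in_top (r := r) (hE.mono fun h => hPE h.1.1.1.1) hT hr hfree (k := 6) ?_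
  refine IsBack.peel_in_top (r := r) (hE.mono fun h => hPE h.1.1.1.1.1) hT hr hfree (k := 0)
    (sparse_zero ?_)
  rintro x t ⟨⟨hx, -⟩, y, ⟨hy, z, hz, hzy⟩, hyx⟩
  -- the four lower out-neighbours of the three tails
  have hrich : ∀ s, s = x ∨ s = y ∨ s = z → ∃ A B T L, P s t ∧ P s A ∧ P s B ∧ P s T ∧ P s L ∧
      t < A ∧ A < B ∧ B < T ∧ T < L := by
    rintro s (rfl | rfl | rfl)
    on_goal 1 => have hs := hx
    on_goal 2 => have hs := hy
    on_goal 3 => have hs := hz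
    all_goals
      obtain ⟨⟨⟨⟨hst, -⟩, -⟩, -⟩, A, ⟨⟨⟨hA, -⟩, -⟩, B,
        ⟨⟨hB, -⟩, T, ⟨hT', L, hL, h4⟩, h3⟩, h2⟩, h1⟩ := hs
      exact ⟨A, B, T, L, hst, hA, hB, hT', hL, h1, h2, h3, h4⟩
  have : Nonempty V := ⟨x⟩
  choose! A B T L hrich using hrich
  clear hx hy hz
  have hbelow : ∀ s, s = x ∨ s = y ∨ s = z → s ≤ x := by
    rintro s (rfl | rfl | rfl)
    exacts [le_rfl, hyx.le, (hzy.trans hyx).le]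
  have hcomp : ∀ s s', s = x ∨ s = y ∨ s = z → s' = x ∨ s' = y ∨ s' = z → L s ≤ L s' ∨ L s' ≤ L s :=
    fun s s' hs hs' => hT.chain ((hE.lt (hPE (hrich s hs).2.2.2.2.1)).le.trans (hbelow s hs))
      ((hE.lt (hPE (hrich s' hs').2.2.2.2.1)).le.trans (hbelow s' hs'))
  -- Choosing s₂ with lowest L places α = L s₀ above t₂ = T s₂, whichever tail s₀ turns out to be.
  have hmin : ∃ s, (s = x ∨ s = y ∨ s = z) ∧ L s ≤ L x ∧ L s ≤ L y ∧ L s ≤ L z := by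
    rcases hcomp x y (by simp) (by simp) with h1 | h1
    · rcases hcomp x z (by simp) (by simp) with h2 | h2
      · exact ⟨x, by simp, le_rfl, h1, h2⟩
      · exact ⟨z, by simp, h2, h2.trans h1, le_rfl⟩
    · rcases hcomp y z (by simp) (by simp) with h2 | h2
      · exact ⟨y, by simp, h1, le_rfl, h2⟩
      · exact ⟨z, by simp, h2.trans h1, h2, le_rfl⟩
  obtain ⟨s₂, hs₂, hminx, hminy, hminz⟩ := hmin
  have hmin : ∀ s, s = x ∨ s = y ∨ s = z → L s₂ ≤ L s := by
    rintro s (rfl | rfl | rfl)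
    exacts [hminx, hminy, hminz]
  obtain ⟨h1, h2, h3, h4, h5, h6, h7, h8, h9⟩ := hrich s₂ hs₂
  obtain ⟨s₁, hs12, hc12, hs1, hpred⟩ := hPpred h4
  -- The extra out-neighbour B guarantees that t₀ lies strictly above A, which plays the role of a.
  obtain ⟨t₀, hBt, htT, ht₀⟩ := hpred _ h8 (hPR h3)
  obtain ⟨σ₀, hσ₀, hσ₀'⟩ := hRtop ht₀
  obtain ⟨σ₂, hσ₂, hσ₂'⟩ := hRtop (hPR h4)
  -- Three tails are needed because s₁ may itself be one of them.
  obtain ⟨s₀, hs₀, h02, h01⟩ : ∃ s₀, (s₀ = x ∨ s₀ = y ∨ s₀ = z) ∧ s₀ ≠ s₂ ∧ s₀ ≠ s₁ := by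
    have hxy := hyx.ne
    have hyz := hzy.ne
    have hxz := (hzy.trans hyx).ne
    clear hrich hPpred hcomp hmin hbelow hpred hstr
    by_cases hx2 : x = s₂ ∨ x = s₁
    · by_cases hy2 : y = s₂ ∨ y = s₁
      · exact ⟨z, by grind⟩
      · exact ⟨y, by grind⟩
    · exact ⟨x, by grind⟩
  obtain ⟨g1, -, -, -, g5, -⟩ := hrich s₀ hs₀
  exact hfree (hE.hasHexagon_of_strict hT hstr h02 h01 hs12
    (hT.chain (hbelow s₀ hs₀) (hbelow s₂ hs₂)) hc12 (hPE g1) (hPE h1) (hPE h2) (hPE h4) (hPE g5)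
    (hRE hs1) (hRE ht₀) hσ₀ hσ₂ h6 (h7.trans_le hBt) htT (h9.trans_le (hmin s₀ hs₀)) hσ₀' hσ₂')

/-- Discarding the highest out-neighbour of each vertex turns the weak inequality into a strict one.
-/
theorem IsBack.sparse_of_crossing (hE : IsBack D E) (hT : D.IsTreeOrder)
    (hr : IsPlaneOrder r) (hfree : ¬ D.HasHexagon)
    (hcr : ∀ {f a α σ}, E f a → E f α → E σ a → σ ≤ f → α ≤ σ) : Sparse 29 E := by
  refine hE.peel_low hT (k := 28) (IsBack.sparse_of_strict (hE.mono fun h => h.1) hT hr hfree ?_)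
  rintro f a α σ ⟨hfa, -⟩ ⟨-, l, hfl, hl⟩ ⟨hσa, -⟩ hle
  exact hl.trans_le (hcr hfa hfl hσa hle)

theorem IsBack.sparse (hE : IsBack D E) (hT : D.IsTreeOrder)
    (hr : IsPlaneOrder r) (hfree : ¬ D.HasHexagon) : Sparse 58 E := by
  -- A survivor f → a has an arc f → α and an arc σ → a nested strictly below it. Two rounds give a
  -- < b < c < g < e < f, the configuration of `hasHexagon_of_nested`.
  have hpeel : ∀ {F : V → V → Prop} {k : ℕ}, IsBack D F →
      Sparse k (fun f a => F f a ∧ ∃ α σ, F f α ∧ F σ a ∧ σ ≤ f ∧ σ < α) → Sparse (29 + k) F := by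
    intro F k hF h
    refine Sparse.split _
      (IsBack.sparse_of_crossing (r := r) (hF.mono fun h => h.1) hT hr hfree ?_) h
    rintro f a α σ ⟨h1, h2⟩ ⟨h3, -⟩ ⟨h5, -⟩ hle
    by_contra hcon
    exact h2 ⟨α, σ, h3, h5, hle,
      lt_of_le_not_ge ((hT.chain (hF.lt h3).le hle).resolve_left hcon) hcon⟩
  refine hpeel hE (k := 29) (hpeel (hE.mono fun h => h.1) (k := 0) (sparse_zero ?_))
  rintro f a ⟨⟨hfa, -⟩, e, g, ⟨hfe, -⟩, ⟨hga, c, b, hgc, hba, -, hbc⟩, -, hge⟩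
  exact hfree (hT.hasHexagon_of_nested (hE.adj hba) (hE.adj hgc) (hE.adj hfe) (hE.adj hfa)
    (hE.lt hba) hbc (hE.lt hgc) hge (hE.lt hfe))

end

/-! ### The breadth-first tree and its orders -/

/-- Reachability from `r` by a walk with `n` arcs. -/
def WalkFrom (D : Digraph V) (r : V) : ℕ → V → Prop
  | 0, v => v = r
  | n + 1, v => ∃ u, WalkFrom D r n u ∧ D.Adj u v

theorem exists_walkFrom {D : Digraph V} {r : V} {p : List V} (hp : p.IsChain D.Adj) {x v : V}
    (hx : p.head? = some x) (hv : p.getLast? = some v) {n : ℕ} (hn : D.WalkFrom r n x) :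
    ∃ m, D.WalkFrom r m v := by
  induction p generalizing x n with
  | nil => simp at hx
  | cons a p ih =>
    simp only [List.head?_cons, Option.some.injEq] at hx
    subst hx
    rcases p with _ | ⟨b, p⟩
    · simp only [List.getLast?_singleton, Option.some.injEq] at hv
      exact ⟨n, hv ▸ hn⟩
    · rw [List.isChain_cons_cons] at hp
      exact ih hp.2 rfl (by simpa using hv) (n := n + 1) ⟨_, hn, hp.1⟩

/-- Distances and parents of a breadth-first search from `r`. -/
structure IsBFS (D : Digraph V) (r : V) (d : V → ℕ) (par : V → V) : Prop where
  root : ∀ v, d v = 0 ↔ v = r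
  par_adj : ∀ v, v ≠ r → D.Adj (par v) v
  par_dist : ∀ v, v ≠ r → d v = d (par v) + 1
  dist_le : ∀ x y, D.Adj x y → d y ≤ d x + 1

theorem IsStronglyConnected.exists_isBFS {D : Digraph V} (h : D.IsStronglyConnected) (r : V) :
    ∃ d par, D.IsBFS r d par := by
  classical
  have hw : ∀ v, ∃ n, D.WalkFrom r n v := fun v => by
    obtain ⟨p, hp⟩ := h r v
    exact exists_walkFrom hp.isChain hp.head hp.last (n := 0) rfl
  have hle : ∀ x y, D.Adj x y → Nat.find (hw y) ≤ Nat.find (hw x) + 1 := fun x y hxy =>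
    Nat.find_min' _ ⟨x, Nat.find_spec (hw x), hxy⟩
  have hpar : ∀ v, ∃ u, v ≠ r → D.Adj u v ∧ Nat.find (hw v) = Nat.find (hw u) + 1 := fun v => by
    by_cases hv : v = r
    · exact ⟨r, fun h => absurd hv h⟩
    · have hs := Nat.find_spec (hw v)
      cases hn : Nat.find (hw v) with
      | zero => rw [hn] at hs; exact absurd hs hv
      | succ n =>
        rw [hn] at hs
        obtain ⟨u, hu, huv⟩ := hs
        have h1 : Nat.find (hw u) ≤ n := Nat.find_min' _ hu
        have h2 := hle u v huv
        exact ⟨u, fun _ => ⟨huv, by omega⟩⟩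
  choose par hpar using hpar
  refine ⟨fun v => Nat.find (hw v), par, fun v => ?_, fun v hv => (hpar v hv).1,
    fun v hv => (hpar v hv).2, hle⟩
  rw [Nat.find_eq_zero]
  rfl

/-- The list of the last `n + 1` vertices on the way from the root to `v`. -/
def treePath (par : V → V) : ℕ → V → List V
  | 0, v => [v]
  | n + 1, v => treePath par n (par v) ++ [v]

/-- Words with a given prefix form a lexicographic interval; this becomes the field `interval` of
`IsPlaneOrder`. -/
theorem prefix_of_lt_of_lt {α : Type*} [LinearOrder α] {p q l : List α} (hpl : p <+: l)
    (hpq : p < q) (hql : q < l) : p <+: q := by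
  induction p generalizing q l with
  | nil => exact List.nil_prefix
  | cons a p ih =>
    obtain ⟨t, rfl⟩ := hpl
    cases q with
    | nil => exact absurd hpq (List.not_lt_nil _)
    | cons b q =>
      rw [List.cons_append] at hql
      rw [List.cons_lt_cons_iff] at hpq hql
      rcases hpq with h1 | ⟨rfl, h1⟩
      · rcases hql with h2 | ⟨rfl, h2⟩
        · exact absurd h1 h2.asymm
        · exact absurd h1 (lt_irrefl _)
      · rcases hql with h2 | ⟨-, h2⟩
        · exact absurd h2 (lt_irrefl _)
        · exact (List.prefix_cons_inj _).2 (ih (List.prefix_append _ _) h1 h2)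

theorem lt_of_prefix {α : Type*} [LinearOrder α] {p l : List α} (hpl : p <+: l)
    (hne : p ≠ l) : p < l := by
  obtain ⟨t, rfl⟩ := hpl
  induction p with
  | nil =>
    cases t with
    | nil => exact absurd rfl hne
    | cons b t => exact List.nil_lt_cons _ _
  | cons a p ih =>
    rw [List.cons_append, List.cons_lt_cons_iff]
    exact Or.inr ⟨rfl, ih fun h => hne (by rw [List.cons_append, ← h])⟩

section BFS

variable {D : Digraph V} {r : V} {d : V → ℕ} {par : V → V}

theorem getLast?_treePath (n : ℕ) (v : V) : (treePath par n v).getLast? = some v := by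
  cases n <;> simp [treePath]

theorem length_treePath (n : ℕ) (v : V) : (treePath par n v).length = n + 1 := by
  induction n generalizing v with
  | zero => rfl
  | succ n ih => simp [treePath, ih]

theorem treePath_injective : Function.Injective fun v => treePath par (d v) v := by
  intro v w h
  have h1 := getLast?_treePath (par := par) (d v) v
  have h2 := getLast?_treePath (par := par) (d w) w
  simp only at h
  rw [h, h2] at h1
  exact (Option.some.inj h1).symm

namespace IsBFS

variable (h : D.IsBFS r d par)

include h

theorem treePath_root : treePath par (d r) r = [r] := by
  rw [(h.root r).2 rfl]
  rfl

theorem treePath_eq {v : V} (hv : v ≠ r) :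
    treePath par (d v) v = treePath par (d (par v)) (par v) ++ [v] := by
  rw [h.par_dist v hv]
  rfl

theorem tree_induction {P : V → Prop} (h0 : P r) (h1 : ∀ v, v ≠ r → P (par v) → P v) (v : V) :
    P v := by
  induction hn : d v generalizing v with
  | zero => exact (h.root v).1 hn ▸ h0
  | succ n ih =>
    have hv : v ≠ r := fun hh => by rw [(h.root v).2 hh] at hn; omega
    exact h1 v hv (ih _ (by have := h.par_dist v hv; omega))

theorem prefix_of_mem {u v : V} (hu : u ∈ treePath par (d v) v) :
    treePath par (d u) u <+: treePath par (d v) v := by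
  revert hu
  refine h.tree_induction (P := fun v => u ∈ treePath par (d v) v →
    treePath par (d u) u <+: treePath par (d v) v) ?_ ?_ v
  · rw [h.treePath_root, List.mem_singleton]
    rintro rfl
    rw [h.treePath_root]
  · intro v hv ih hu
    rw [h.treePath_eq hv, List.mem_append, List.mem_singleton] at hu
    rcases hu with hu | rfl
    · exact (ih hu).trans (h.treePath_eq hv ▸ List.prefix_append _ _)
    · exact List.prefix_rfl

theorem isChain_treePath (v : V) : (treePath par (d v) v).IsChain D.Adj := by
  refine h.tree_induction (P := fun v => (treePath par (d v) v).IsChain D.Adj) ?_ ?_ v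
  · rw [h.treePath_root]
    exact List.isChain_singleton _
  · intro v hv ih
    rw [h.treePath_eq hv]
    refine List.IsChain.append ih (List.isChain_singleton _) fun z hz w hw => ?_
    rw [getLast?_treePath, Option.mem_some_iff] at hz
    simp only [List.head?_cons, Option.mem_some_iff] at hw
    exact hz ▸ hw ▸ h.par_adj v hv

theorem nodup_treePath (v : V) : (treePath par (d v) v).Nodup := by
  refine h.tree_induction (P := fun v => (treePath par (d v) v).Nodup) ?_ ?_ v
  · rw [h.treePath_root]
    exact List.nodup_singleton _
  · intro v hv ih
    rw [h.treePath_eq hv, List.nodup_append]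
    refine ⟨ih, List.nodup_singleton _, fun a ha b hb => ?_⟩
    rw [List.mem_singleton] at hb
    rintro rfl
    have h1 := (h.prefix_of_mem ha).length_le
    rw [length_treePath, length_treePath, hb] at h1
    have := h.par_dist v hv
    omega

omit h in
/-- The ancestor order of the search tree. -/
@[reducible]
def order (d : V → ℕ) (par : V → V) : PartialOrder V where
  le x y := treePath par (d x) x <+: treePath par (d y) y
  le_refl _ := List.prefix_rfl
  le_trans _ _ _ := List.IsPrefix.trans
  le_antisymm x y h1 h2 :=
    treePath_injective (d := d) (par := par) (h1.eq_of_length_le h2.length_le)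

theorem isTreeOrder (hD : ∀ x, ¬ D.Adj x x) : @IsTreeOrder V (order d par) D := by
  let _ := order d par
  have le_def : ∀ {x y : V}, x ≤ y ↔ treePath par (d x) x <+: treePath par (d y) y := Iff.rfl
  have hroot : ∀ v : V, r ≤ v := h.tree_induction le_rfl fun v hv ih =>
    le_trans ih (h.treePath_eq hv ▸ List.prefix_append _ _ :
      treePath par (d (par v)) (par v) <+: treePath par (d v) v)
  have hchain : ∀ {x y z : V}, x ≤ z → y ≤ z → x ≤ y ∨ y ≤ x := fun h1 h2 =>
    List.prefix_or_prefix_of_prefix h1 h2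
  have hdist : ∀ {x y : V}, x ≤ y → d x ≤ d y := fun h1 => by
    have := List.IsPrefix.length_le (le_def.1 h1)
    rw [length_treePath, length_treePath] at this
    omega
  have heq : ∀ {x y : V}, x ≤ y → d y ≤ d x → x = y := fun {x y} h1 h2 => by
    refine treePath_injective (d := d) (par := par) (List.IsPrefix.eq_of_length_le (le_def.1 h1) ?_)
    rw [length_treePath, length_treePath]
    omega
  refine ⟨hD, hchain, fun x y => ?_, fun {x y} hxy => ?_⟩
  · by_contra! hcon
    -- Without a greatest common ancestor there would be common ancestors of unbounded depth.
    have key : ∀ n, ∃ z, z ≤ x ∧ z ≤ y ∧ n ≤ d z := fun n => by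
      induction n with
      | zero => exact ⟨r, hroot x, hroot y, Nat.zero_le _⟩
      | succ n ih =>
        obtain ⟨z, hx, hy, hz⟩ := ih
        obtain ⟨w, hwx, hwy, hwz⟩ := hcon z hx hy
        have hzw := (hchain hx hwx).resolve_right hwz
        refine ⟨w, hwx, hwy, ?_⟩
        by_contra hlt
        exact hwz (heq hzw (by omega)).ge
    obtain ⟨z, hz, -, hn⟩ := key (d x + 1)
    have := hdist hz
    omega
  · obtain ⟨l, hl⟩ := id hxy
    obtain ⟨i, hi⟩ := List.getLast?_eq_some_iff.1 (getLast?_treePath (par := par) (d x) x)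
    have hy : i ++ (x :: l) = treePath par (d y) y := by rw [← hl, hi]; simp
    have hnd := h.nodup_treePath y
    refine ⟨x :: l, ⟨?_, ?_, rfl, ?_⟩, fun v hv => ?_⟩
    · exact (h.isChain_treePath y).suffix ⟨i, hy⟩
    · rw [← hy] at hnd
      exact (List.nodup_append.1 hnd).2.1
    · rw [← getLast?_treePath (par := par) (d y) y, ← hy]
      rw [List.getLast?_append, List.getLast?_cons, Option.some_or]
    · have hvy : v ∈ treePath par (d y) y := hy ▸ List.mem_append_right _ hv
      have hvy' : v ≤ y := h.prefix_of_mem hvy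
      refine ⟨(hchain hxy hvy').elim id fun hvx => ?_, hvy'⟩
      rcases List.mem_cons.1 hv with rfl | hvl
      · exact le_rfl
      · have hmem : v ∈ treePath par (d x) x :=
          List.IsPrefix.subset hvx (List.mem_of_getLast? (getLast?_treePath (d v) v))
        rw [← hl] at hnd
        exact absurd rfl ((List.nodup_append.1 hnd).2.2 v hmem v hvl)

/-- An arc raises the distance by at most 1, so it cannot skip a level of the tree. -/
theorem par_of_lt {x y : V} (hxy : @LT.lt V (order d par).toLT x y) (hadj : D.Adj x y) :
    x = par y := by
  let _ := order d par
  have hle : treePath par (d x) x <+: treePath par (d y) y := hxy.le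
  have h1 := h.dist_le x y hadj
  have hy : y ≠ r := by
    rintro rfl
    have := hle.length_le
    rw [length_treePath, length_treePath, (h.root y).2 rfl] at this
    exact hxy.ne ((h.root x).1 (by omega))
  have h2 := h.par_dist y hy
  rw [h.treePath_eq hy, List.prefix_concat_iff] at hle
  rcases hle with hle | hle
  · rw [← h.treePath_eq hy] at hle
    exact absurd (treePath_injective (d := d) (par := par) hle) hxy.ne
  · refine treePath_injective (d := d) (par := par) (hle.eq_of_length_le ?_)
    rw [length_treePath, length_treePath]
    omega

omit h in
-- Vertices are compared lexicographically by their root paths, after an arbitrary numbering.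
theorem exists_isPlaneOrder [Finite V] : ∃ s : V → V → Prop, @IsPlaneOrder V (order d par) s := by
  let _ := order d par
  obtain ⟨n, ⟨e⟩⟩ := Finite.exists_equiv_fin V
  have hinj : Function.Injective fun v => (treePath par (d v) v).map e :=
    (List.map_injective_iff.2 e.injective).comp treePath_injective
  have hle : ∀ {x y : V}, x ≤ y → (treePath par (d x) x).map e <+: (treePath par (d y) y).map e :=
    fun h => (List.prefix_map_iff_of_injective e.injective).2 h
  refine ⟨fun x y => (treePath par (d x) x).map e < (treePath par (d y) y).map e, lt_asymm,
    lt_trans, fun hne => lt_or_gt_of_ne (hinj.ne hne),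
    fun hlt => lt_of_prefix (hle hlt.le) (hinj.ne hlt.ne), fun hxz hxy hyz => ?_⟩
  exact (List.prefix_map_iff_of_injective e.injective).1
    (prefix_of_lt_of_lt (hle hxz) hxy hyz)

end IsBFS

end BFS

/-! ### Assembling the bound: 115 = 1 + 58 + 28 + 28 -/

theorem sparse_adj_of_not_hasHexagon [Finite V] {D : Digraph V} (hD : D.IsOriented)
    (hstrong : D.IsStronglyConnected) (hfree : ¬ D.HasHexagon) : Sparse 115 D.Adj := by
  rcases isEmpty_or_nonempty V with hV | ⟨⟨r⟩⟩
  · exact fun S => by simp [Finset.eq_empty_of_isEmpty S]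
  obtain ⟨d, par, h⟩ := hstrong.exists_isBFS r
  let _ := IsBFS.order d par
  have hT : D.IsTreeOrder := h.isTreeOrder fun x hx => hD x x hx hx
  obtain ⟨s, hs⟩ := IsBFS.exists_isPlaneOrder (d := d) (par := par)
  have h1 : Sparse 1 fun x y => D.Adj x y ∧ x < y := sparse_one_of_in fun x x' y hx hx' =>
    (h.par_of_lt hx.2 hx.1).trans (h.par_of_lt hx'.2 hx'.1).symm
  have h2 : Sparse 58 fun x y => D.Adj x y ∧ y < x :=
    IsBack.sparse (D := D) ⟨fun h => h.1, fun h => h.2⟩ hT hs hfree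
  have h3 : Sparse 28 fun x y => D.Adj x y ∧ ¬ x ≤ y ∧ ¬ y ≤ x ∧ s y x :=
    IsCross.sparse (D := D) (r := s) ⟨fun h => h.1, fun h => h.2.2.2, fun h => h.2.2.1⟩ hT hs hfree
  have h4 : Sparse 28 fun x y => D.Adj x y ∧ ¬ x ≤ y ∧ ¬ y ≤ x ∧ s x y :=
    IsCross.sparse (D := D) ⟨fun h => h.1, fun h => Or.inr ⟨h.2.2.1, h.2.1, h.2.2.2⟩,
      fun h => h.2.2.1⟩ hT hs.mirror hfree
  refine (h1.union h2 (G := fun x y => D.Adj x y ∧ (x < y ∨ y < x)) fun x y h => ?_).union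
    (h3.union h4 (G := fun x y => D.Adj x y ∧ ¬ x ≤ y ∧ ¬ y ≤ x) fun x y h => ?_) fun x y h => ?_
  · exact h.2.imp (fun h' => ⟨h.1, h'⟩) fun h' => ⟨h.1, h'⟩
  · rcases hs.total (fun hh => h.2.1 hh.le : x ≠ y) with h' | h'
    · exact Or.inr ⟨h.1, h.2.1, h.2.2, h'⟩
    · exact Or.inl ⟨h.1, h.2.1, h.2.2, h'⟩
  · have hne := hT.ne h
    by_cases hxy : x ≤ y
    · exact Or.inl ⟨h, Or.inl (lt_of_le_of_ne hxy hne)⟩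
    by_cases hyx : y ≤ x
    · exact Or.inl ⟨h, Or.inr (lt_of_le_of_ne hyx hne.symm)⟩
    exact Or.inr ⟨h, hxy, hyx⟩

end Digraph

theorem mainTheorem2 {V : Type*} [Finite V] (D : Digraph V) (hD : D.IsOriented)
    (hstrong : D.IsStronglyConnected)
    (hfree : ¬ D.ContainsSubdivision (Digraph.blockCycle [1, 1, 1, 1, 1, 1])) :
    D.chromaticNumber ≤ 7 * 16 ^ 2 := by
  refine (Digraph.sparse_adj_of_not_hasHexagon hD hstrong hfree).chromaticNumber_le.trans ?_
  norm_num
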